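/- Let $d\ge 0$, $N\ge 0$, $k\ge 1$ be integers and $\gamma>0$. There is a polynomial $Q=Q_{N,k}$ in three variables, depending only on $d,\gamma,N,k$, such that the following holds. **Setting.** Let $\xi$ be a random variable with values in $\Xi$, and let $f(\cdot;\xi)\in C^3(\mathbb R^d)$, $\xi\in\Xi$, be functions whose gradients have finite second moments and satisfy $\mathbb E_\xi[\nabla f(x;\xi)]=\nabla f(x)$ for all $x\in\mathbb R^d$, where $f:\mathbb R^d\to\mathbb R$ is differentiable and has a local minimum at $0$. Let $b>0$ and $R_1>R_0:=\frac{16b}{3\gamma}$ be such that for every $\xi\in\Xi$ the function $f(\cdot;\xi)-\frac{\gamma}{2}\|\cdot\|^2$ is convex on the ball $B(0,R_1)$ and $\|\nabla f(0;\xi)\|\le b$. Let $R\in(R_0,R_1]$ and $0<\eta\le\eta_0:=\min\big\{\frac1{2\gamma},\frac{3R}{8b},\frac{3\gamma R^2/8-2bR}{2\gamma bR+b^2}\big\}$. Put $$\Sigma=\mathbb E_\xi\big[(\nabla f(\cdot;\xi)-\nabla f)\otimes(\nabla f(\cdot;\xi)-\nabla f)\big],\qquad \mathcal L_1=-\nabla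 f\cdot\nabla,\qquad \mathcal L_2=-\tfrac14\nabla\|\nabla f\|^2\cdot\nabla+\tfrac12\mathrm{Tr}(\Sigma\nabla^2).$$ For an open ball $B$, $C^m(B)$ denotes the $m$ times continuously differentiable functions on $B$ all of whose derivatives of order at most $m$ are bounded on $B$, with the supremum of these derivatives as the norm. Assume, with $B=B(0,R)$ the open ball, that $$\varphi\in C^{2k+2N}(B),\qquad f\in C^{2k+1+2N}(B),\qquad \Sigma\in C^{2k+2N-2}(B).$$ Let $u_0,\dots,u_N$ be classical solutions ($C^1$ in $(x,t)$ and $C^2$ in $x$) on $B\times[0,\infty)$ of $$\partial_tu_0=\mathcal L_1u_0,\quad u_0(\cdot,0)=\varphi;\qquad \partial_tu_\ell=\mathcal L_1u_\ell+\mathcal L_2u_{\ell-1},\quad u_\ell(\cdot,0)=0\quad(1\le\ell\le N),$$ and let $u^N=\sum_{\ell=0}^N\eta^\ell u_\ell$. **Conclusion.** Each $u_\ell$, $0\le\ell\le N$, is of class $C^{2k+2(N-\ell)}$ in $(x,t)$ on $B\times[0,\infty)$, so that all derivatives below exist; on $B\times[0,\infty)$ $$\partial_tu^N=(\mathcal L_1+\eta\mathcal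 L_2)u^N-\eta^{N+1}\mathcal L_2u_N;$$ and for all $t\ge0$ $$\sup_{x\in B(0,R)}\big|\partial_t^ku^N-(\mathcal L_1+\eta\mathcal L_2)^ku^N\big|\le C(N,R)\,e^{-\gamma t/2}\,\eta^{N+1},$$ $$C(N,R)=Q_{N,k}\big(\|\varphi\|_{C^{2k+2N}(B)},\ \|f\|_{C^{2k+1+2N}(B)},\ \|\Sigma\|_{C^{2k+2N-2}(B)}\big).$$ -/

import Mathlib

open MeasureTheory Set Metric
open scoped ENNReal

noncomputable section

namespace SGDExpansion

/-- The `C^m(U)` norm (`U` open) of a vector-valued function: the supremum over `U` of the norms of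
all derivatives of order at most `m`, as an extended nonnegative number. -/
def ckNorm {d : ℕ} {V : Type*} [NormedAddCommGroup V] [NormedSpace ℝ V]
    (m : ℕ) (U : Set (EuclideanSpace ℝ (Fin d))) (g : EuclideanSpace ℝ (Fin d) → V) : ℝ≥0∞ :=
  ⨆ j : Fin (m + 1), ⨆ x ∈ U, ‖iteratedFDeriv ℝ (j : ℕ) g x‖ₑ

/-- `g ∈ C^m(U)` (`U` open): `g` is `m` times continuously differentiable on `U`, with finite
`C^m(U)` norm. -/
def MemCk {d : ℕ} {V : Type*} [NormedAddCommGroup V] [NormedSpace ℝ V]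
    (m : ℕ) (U : Set (EuclideanSpace ℝ (Fin d))) (g : EuclideanSpace ℝ (Fin d) → V) : Prop :=
  ContDiffOn ℝ m g U ∧ ckNorm m U g < ⊤

/-- The Hessian matrix of a scalar function. -/
def hessian {d : ℕ} (v : EuclideanSpace ℝ (Fin d) → ℝ) (x : EuclideanSpace ℝ (Fin d)) :
    Matrix (Fin d) (Fin d) ℝ :=
  Matrix.of fun i j => fderiv ℝ (fderiv ℝ v) x
    (EuclideanSpace.single i (1 : ℝ)) (EuclideanSpace.single j (1 : ℝ))

/-- The covariance matrix `Σ(x)` of the random gradient `∇f(x;ξ)`, whose mean is `∇f(x)`. -/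
def covMatrix {d : ℕ} {Ξ : Type*} [MeasurableSpace Ξ] (P : Measure Ξ)
    (F : Ξ → EuclideanSpace ℝ (Fin d) → ℝ) (f : EuclideanSpace ℝ (Fin d) → ℝ)
    (x : EuclideanSpace ℝ (Fin d)) : Matrix (Fin d) (Fin d) ℝ :=
  Matrix.of fun i j => ∫ ξ, (gradient (F ξ) x - gradient f x) i *
    (gradient (F ξ) x - gradient f x) j ∂P

/-- `L₁ v = -∇f · ∇v`. -/
def L1 {d : ℕ} (f v : EuclideanSpace ℝ (Fin d) → ℝ) (x : EuclideanSpace ℝ (Fin d)) : ℝ :=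
  -(inner ℝ (gradient f x) (gradient v x))

/-- `L₂ v = -(1/4) ∇‖∇f‖² · ∇v + (1/2) Tr(S ∇²v)`. -/
def L2 {d : ℕ} (f : EuclideanSpace ℝ (Fin d) → ℝ)
    (S : EuclideanSpace ℝ (Fin d) → Matrix (Fin d) (Fin d) ℝ)
    (v : EuclideanSpace ℝ (Fin d) → ℝ) (x : EuclideanSpace ℝ (Fin d)) : ℝ :=
  -(1 / 4) * inner ℝ (gradient (fun y => ‖gradient f y‖ ^ 2) x) (gradient v x)
    + (1 / 2) * (S x * hessian v x).trace

/-- `L₁ + η L₂`. -/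
def LL {d : ℕ} (f : EuclideanSpace ℝ (Fin d) → ℝ)
    (S : EuclideanSpace ℝ (Fin d) → Matrix (Fin d) (Fin d) ℝ) (η : ℝ)
    (v : EuclideanSpace ℝ (Fin d) → ℝ) (x : EuclideanSpace ℝ (Fin d)) : ℝ :=
  L1 f v x + η * L2 f S v x

/-- The standing assumptions on the random functions `F ξ = f(·;ξ)`, where `ξ` has law `P`, and on
the objective `f`: the random gradients are unbiased estimates of `∇f` with finite second moments,
`f` has a local minimum at `0`, each `f(·;ξ)` is `C³` and `γ`-strongly convex on `B(0,R₁)`, and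
the random gradients at `0` are bounded by `b`. -/
structure Assumption {d : ℕ} {Ξ : Type*} [MeasurableSpace Ξ] (P : Measure Ξ)
    (F : Ξ → EuclideanSpace ℝ (Fin d) → ℝ) (f : EuclideanSpace ℝ (Fin d) → ℝ)
    (γ b R₁ : ℝ) : Prop where
  contDiff : ∀ ξ, ContDiff ℝ 3 (F ξ)
  memLp : ∀ x, MemLp (fun ξ => gradient (F ξ) x) 2 P
  unbiased : ∀ x, HasGradientAt f (∫ ξ, gradient (F ξ) x ∂P) x
  localMin : IsLocalMin f 0
  strongConvex : ∀ ξ, StrongConvexOn (ball 0 R₁) γ (F ξ)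
  b_pos : 0 < b
  gradient_le : ∀ ξ, ‖gradient (F ξ) 0‖ ≤ b
  lt_R₁ : 16 * b / (3 * γ) < R₁

/-- The threshold `η₀` for the step size. -/
def stepBound (γ b R : ℝ) : ℝ :=
  min (1 / (2 * γ)) (min (3 * R / (8 * b))
    ((3 * γ * R ^ 2 / 8 - 2 * b * R) / (2 * γ * b * R + b ^ 2)))

/-- `v = v(x,t)` is a classical solution on `B(0,R) × [0,∞)` of the Cauchy problem
`∂ₜ v = L₁ v + g`, `v(·,0) = v₀`: it is `C¹` in `(x,t)`, it is `C²` in `x`, and the equation holds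
pointwise (with the one-sided derivative at `t = 0`). -/
structure IsTransportSolution {d : ℕ} (f : EuclideanSpace ℝ (Fin d) → ℝ) (R : ℝ)
    (g : EuclideanSpace ℝ (Fin d) → ℝ → ℝ) (v₀ : EuclideanSpace ℝ (Fin d) → ℝ)
    (v : EuclideanSpace ℝ (Fin d) → ℝ → ℝ) : Prop where
  contDiffOn : ContDiffOn ℝ 1 (fun p : EuclideanSpace ℝ (Fin d) × ℝ => v p.1 p.2)
    (ball 0 R ×ˢ Ici 0)
  contDiffOn_space : ∀ t, 0 ≤ t → ContDiffOn ℝ 2 (fun x => v x t) (ball 0 R)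
  eqn : ∀ x ∈ ball (0 : EuclideanSpace ℝ (Fin d)) R, ∀ t, 0 ≤ t →
    HasDerivWithinAt (v x) (L1 f (fun y => v y t) x + g x t) (Ici 0) t
  init : ∀ x ∈ ball (0 : EuclideanSpace ℝ (Fin d)) R, v x 0 = v₀ x

/-- `u 0, …, u N` are the first `N + 1` coefficients of the formal expansion on
`B(0,R) × [0,∞)`: `∂ₜ u₀ = L₁ u₀`, `u₀(·,0) = φ`, and
`∂ₜ u_{ℓ+1} = L₁ u_{ℓ+1} + L₂ u_ℓ`, `u_{ℓ+1}(·,0) = 0`. -/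
structure IsExpansion {d : ℕ} (f : EuclideanSpace ℝ (Fin d) → ℝ)
    (S : EuclideanSpace ℝ (Fin d) → Matrix (Fin d) (Fin d) ℝ)
    (φ : EuclideanSpace ℝ (Fin d) → ℝ) (R : ℝ) (N : ℕ)
    (u : ℕ → EuclideanSpace ℝ (Fin d) → ℝ → ℝ) : Prop where
  zero : IsTransportSolution f R (fun _ _ => 0) φ (u 0)
  succ : ∀ l < N, IsTransportSolution f R (fun x t => L2 f S (fun y => u l y t) x)
    (fun _ => 0) (u (l + 1))

/-- The truncated series `u^N(x,t) = ∑_{ℓ ≤ N} η^ℓ u_ℓ(x,t)`. -/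
def truncation {d : ℕ} (u : ℕ → EuclideanSpace ℝ (Fin d) → ℝ → ℝ) (η : ℝ) (N : ℕ)
    (x : EuclideanSpace ℝ (Fin d)) (t : ℝ) : ℝ :=
  ∑ l ∈ Finset.range (N + 1), η ^ l * u l x t

end SGDExpansion

end

/-! Averaging the strong convexity of the `F ξ` over `ξ` makes `∇f` strongly monotone with constant
`γ` on the ball, and `∇f(0) = 0` because `0` is a local minimum. The field `V = -∇f` therefore
points inward and contracts, and everything is read off along its flow `X`.

To avoid working on a ball, fix `x₀` in `B(0,R)` and a radius `r` strictly between `‖x₀‖` and `R`,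
and multiply the data by a bump function equal to `1` on `B(0,r)` (`exists_coefficients`). The new
field is compactly supported, so it has a global flow, which is as smooth as the field
(`IsFlow.contDiff`). Forward trajectories from `B(0,r)` stay there and never see the cutoff. The
bound `M` on the data does not involve `r`, so the final estimate is uniform in `x₀`.

By the method of characteristics a classical solution must be given by Duhamel's formula
(`IsExpansion.eq_coeff`): `u₀(x,t) = φ(X x t)`, and `u_{l+1}(x,t)` is the integral over `s` in
`[0,t]` of `𝓛₂ u_l(·,s)` evaluated at `X x (t-s)`. Each stage costs two derivatives, which gives the
regularity claim.

For decay, the spatial derivatives of `X` of order at least one are `O(e^{-γt})`: the one of order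
`i+1` solves the variational equation, which is dissipative with rate `γ`, with a forcing quadratic
in lower derivatives and hence `O(e^{-2γt})` (`exists_flow_decay`). The chain rule and Duhamel's
formula pass this on to the `u_l`, at any rate `a < γ`; only derivatives of order at least one
decay, but `𝓛₁` and `𝓛₂` see no others. Time derivatives are exchanged for spatial ones through the
equations. All constants have the form `C M^p`, with `C` and `p` independent of the data.

Finally put `𝓛 = 𝓛₁ + η𝓛₂` and `E_j = ∂ₜʲu^N - 𝓛ʲu^N`. The equation `∂ₜu^N = 𝓛u^N - η^{N+1}𝓛₂u_N`
gives `E₀ = 0` and `E_{j+1} = 𝓛E_j - η^{N+1}𝓛₂∂ₜʲu_N`, so `E_k` is `O(η^{N+1}e^{-at})` by induction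
(`exists_residual_decay`). The theorem takes `a = γ/2`. -/

namespace SGDExpansion

open Filter Topology
open scoped NNReal

universe w

/-! ### Smoothness of the superposition operator on spaces of continuous functions -/

section Postcomp

variable {K : Type*} [TopologicalSpace K] [CompactSpace K]

/-- A continuous family of continuous linear maps acts on continuous functions. -/
noncomputable def pointwiseApply (K : Type*) [TopologicalSpace K] [CompactSpace K]
    (E F : Type*) [NormedAddCommGroup E] [NormedSpace ℝ E] [NormedAddCommGroup F]
    [NormedSpace ℝ F] : C(K, E →L[ℝ] F) →L[ℝ] C(K, E) →L[ℝ] C(K, F) :=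
  LinearMap.mkContinuous₂
    (LinearMap.mk₂ ℝ (fun (A : C(K, E →L[ℝ] F)) (c : C(K, E)) =>
      (⟨fun s => A s (c s), by fun_prop⟩ : C(K, F)))
      (fun A B c => by ext s; simp) (fun r A c => by ext s; simp)
      (fun A c c' => by ext s; simp) (fun r A c => by ext s; simp)) 1
    (fun A c => by
      rw [ContinuousMap.norm_le _ (by positivity)]
      intro s
      rw [one_mul]
      exact ((A s).le_opNorm _).trans
        (mul_le_mul (A.norm_coe_le_norm s) (c.norm_coe_le_norm s) (norm_nonneg (c s)) (norm_nonneg A)))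

/-- `V'` need not be uniformly continuous, but it is so near the compact range of `c`. The mean
value inequality on balls centred at the points `c s` then gives a remainder that is uniform in `s`.
-/
theorem hasFDerivAt_postcomp {E F : Type*} [NormedAddCommGroup E] [NormedSpace ℝ E]
    [NormedAddCommGroup F] [NormedSpace ℝ F] {V : C(E, F)} {V' : C(E, E →L[ℝ] F)}
    (hV : ∀ x, HasFDerivAt V (V' x) x) (c : C(K, E)) :
    HasFDerivAt (fun c : C(K, E) => V.comp c) (pointwiseApply K E F (V'.comp c)) c := by
  rw [hasFDerivAt_iff_isLittleO_nhds_zero, Asymptotics.isLittleO_iff]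
  intro ε hε
  have hu := (isCompact_range c.continuous).uniformContinuousAt_of_continuousAt V'
    (fun a _ => V'.continuous.continuousAt) (dist_mem_uniformity hε)
  obtain ⟨δ, hδ, hball⟩ := mem_uniformity_dist.1 hu
  filter_upwards [ball_mem_nhds (0 : C(K, E)) hδ] with h hh
  rw [ContinuousMap.norm_le _ (by positivity)]
  intro s
  have hs : ‖h s‖ < δ := (h.norm_coe_le_norm s).trans_lt (by simpa using hh)
  have key := (convex_ball (c s) δ).norm_image_sub_le_of_norm_hasFDerivWithin_le' (f := V)
    (f' := V') (φ := V' (c s)) (C := ε) (x := c s) (y := c s + h s)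
    (fun x _ => (hV x).hasFDerivWithinAt)
    (fun x hx => by
      have := hball (a := c s) (b := x) (by simpa [dist_comm] using hx) (mem_range_self s)
      rw [mem_ofPred_eq, dist_comm, dist_eq_norm] at this
      exact this.le)
    (mem_ball_self hδ) (by simpa [dist_eq_norm] using hs)
  rw [add_sub_cancel_left] at key
  exact key.trans (mul_le_mul_of_nonneg_left (h.norm_coe_le_norm s) hε.le)

/-- The derivative is again a superposition operator, with `fderiv ℝ V` in place of `V`, so
induction on `n` applies once the target space is allowed to vary. The common universe keeps `E
→L[ℝ] F` among the admissible targets. -/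
theorem contDiff_postcomp {E : Type w} [NormedAddCommGroup E] [NormedSpace ℝ E] (n : ℕ) :
    ∀ {F : Type w} [NormedAddCommGroup F] [NormedSpace ℝ F] (V : C(E, F)),
      ContDiff ℝ n V → ContDiff ℝ n (fun c : C(K, E) => V.comp c) := by
  induction n with
  | zero =>
    intro F _ _ V _
    simpa [contDiff_zero] using ContinuousMap.continuous_postcomp V
  | succ n ih =>
    intro F _ _ V hV
    have h1 : ContDiff ℝ n (fderiv ℝ V) := hV.fderiv_right (by norm_cast)
    rw [Nat.cast_succ, contDiff_succ_iff_hasFDerivAt]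
    have h2 := ih ⟨fderiv ℝ V, h1.continuous⟩ h1
    have h3 : ContDiff ℝ n (pointwiseApply K E F) := ContinuousLinearMap.contDiff _
    refine ⟨fun c => pointwiseApply K E F ((⟨fderiv ℝ V, h1.continuous⟩ : C(E, E →L[ℝ] F)).comp c),
      h3.comp h2, fun c => ?_⟩
    exact hasFDerivAt_postcomp (fun x => (hV.differentiable (by simp)).differentiableAt.hasFDerivAt) c

end Postcomp

/-! ### Joint smoothness of partial derivatives, and differentiation under the integral sign -/

theorem contDiff_fderiv_fst {G : Type*} [NormedAddCommGroup G] [NormedSpace ℝ G]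
    {P S : Type*} [NormedAddCommGroup P] [NormedSpace ℝ P]
     [NormedAddCommGroup S] [NormedSpace ℝ S] {m n : ℕ} (hmn : n + 1 ≤ m)
    {F : P → S → G} (hF : ContDiff ℝ m (fun p : P × S => F p.1 p.2)) :
    ContDiff ℝ n (fun p : P × S => fderiv ℝ (fun q => F q p.2) p.1) :=
  ContDiff.fderiv (f := fun (q : P × S) q' => F q' q.2) (m := m) (n := n)
    (hF.comp (contDiff_snd.prodMk (contDiff_snd.comp contDiff_fst))) contDiff_fst
    (by exact_mod_cast hmn)

theorem contDiff_iteratedFDeriv_fst {G : Type*} [NormedAddCommGroup G] [NormedSpace ℝ G]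
    {P S : Type*} [NormedAddCommGroup P] [NormedSpace ℝ P] [NormedAddCommGroup S] [NormedSpace ℝ S]
    {F : P → S → G} (j : ℕ) : ∀ {m n : ℕ}, n + j ≤ m →
    ContDiff ℝ m (fun p : P × S => F p.1 p.2) →
    ContDiff ℝ n (fun p : P × S => iteratedFDeriv ℝ j (fun q => F q p.2) p.1) := by
  induction j with
  | zero =>
    intro m n hmn hF
    simp only [iteratedFDeriv_zero_eq_comp, Function.comp_apply]
    exact (LinearIsometryEquiv.contDiff _).comp (hF.of_le (by exact_mod_cast hmn))
  | succ j ih =>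
    intro m n hmn hF
    have h := contDiff_fderiv_fst (F := fun p s => iteratedFDeriv ℝ j (fun q => F q s) p)
      (m := n + 1) (n := n) le_rfl (ih (n := n + 1) (by omega) hF)
    simp only [iteratedFDeriv_succ_eq_comp_left, Function.comp_apply]
    exact (LinearIsometryEquiv.contDiff _).comp h

section ParametricIntegral

variable {P : Type w} [NormedAddCommGroup P] [NormedSpace ℝ P] [ProperSpace P]

theorem hasFDerivAt_parametric_intervalIntegral {G : Type*} [NormedAddCommGroup G]
    [NormedSpace ℝ G] {F : P → ℝ → G} (hF : ContDiff ℝ 1 (fun p : P × ℝ => F p.1 p.2)) (a b : ℝ)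
    (p : P) : HasFDerivAt (fun p => ∫ s in a..b, F p s) (∫ s in a..b, fderiv ℝ (fun q => F q s) p)
      p := by
  have h1 : Continuous (fun q : P × ℝ => fderiv ℝ (fun q' => F q' q.2) q.1) := by
    have : ContDiff ℝ 0 (fun q : P × ℝ => fderiv ℝ (fun q' => F q' q.2) q.1) :=
      ContDiff.fderiv (f := fun (q : P × ℝ) q' => F q' q.2) (m := 1) (n := 0)
        (hF.comp (contDiff_snd.prodMk (contDiff_snd.comp contDiff_fst))) contDiff_fst (by simp)
    exact this.continuous
  obtain ⟨C, hC⟩ := ((isCompact_closedBall p 1).prod (isCompact_uIcc (a := a) (b := b))).exists_bound_of_continuousOn h1.continuousOn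
  refine intervalIntegral.hasFDerivAt_integral_of_dominated_of_fderiv_le
    (F' := fun q s => fderiv ℝ (fun q => F q s) q) (bound := fun _ => C)
    (closedBall_mem_nhds p one_pos) ?_ ?_ ?_ ?_ ?_ ?_
  · refine Eventually.of_forall fun q => ?_
    have : Continuous (F q) := hF.continuous.comp (Continuous.prodMk_right q)
    exact this.aestronglyMeasurable
  · have : Continuous (F p) := hF.continuous.comp (Continuous.prodMk_right p)
    exact this.intervalIntegrable _ _
  · exact (h1.comp (Continuous.prodMk_right p)).aestronglyMeasurable
  · exact Eventually.of_forall fun s hs q hq => hC (q, s) ⟨hq, uIoc_subset_uIcc hs⟩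
  · exact intervalIntegrable_const
  · refine Eventually.of_forall fun s _ q _ => ?_
    have : ContDiff ℝ 1 (fun q => F q s) := hF.comp (contDiff_prodMk_left s)
    exact (this.differentiable one_ne_zero).differentiableAt.hasFDerivAt

theorem contDiff_parametric_intervalIntegral (m : ℕ) (a b : ℝ) :
    ∀ {G : Type w} [NormedAddCommGroup G] [NormedSpace ℝ G] (F : P → ℝ → G),
      ContDiff ℝ m (fun p : P × ℝ => F p.1 p.2) → ContDiff ℝ m (fun p => ∫ s in a..b, F p s) := by
  induction m with
  | zero =>
    intro G _ _ F hF
    have hc : Continuous (Function.uncurry F) := hF.continuous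
    simpa [contDiff_zero] using
      intervalIntegral.continuous_parametric_intervalIntegral_of_continuous' hc a b
  | succ m ih =>
    intro G _ _ F hF
    rw [Nat.cast_succ, contDiff_succ_iff_hasFDerivAt]
    exact ⟨_, ih _ (contDiff_fderiv_fst le_rfl hF), fun p =>
      hasFDerivAt_parametric_intervalIntegral (hF.of_le (by simp)) a b p⟩

set_option maxSynthPendingDepth 4 in
theorem iteratedFDeriv_intervalIntegral {G : Type*} [NormedAddCommGroup G]
    [NormedSpace ℝ G] [CompleteSpace G] {F : P → ℝ → G} (a b : ℝ) (j : ℕ) {m : ℕ} (hj : j ≤ m)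
    (hF : ContDiff ℝ m (fun p : P × ℝ => F p.1 p.2)) (p : P) :
    iteratedFDeriv ℝ j (fun p => ∫ s in a..b, F p s) p =
      ∫ s in a..b, iteratedFDeriv ℝ j (fun q => F q s) p := by
  induction j generalizing p with
  | zero =>
    simp only [iteratedFDeriv_zero_eq_comp, Function.comp_apply]
    exact (ContinuousLinearMap.intervalIntegral_comp_comm
      (continuousMultilinearCurryFin0 ℝ P G).symm.toContinuousLinearEquiv.toContinuousLinearMap
      ((hF.continuous.comp (Continuous.prodMk_right p)).intervalIntegrable _ _)).symm
  | succ j ih =>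
    have h1 : iteratedFDeriv ℝ j (fun p => ∫ s in a..b, F p s) =
      fun p => ∫ s in a..b, iteratedFDeriv ℝ j (fun q => F q s) p :=
      funext fun p => ih (by omega) p
    have h2 := contDiff_iteratedFDeriv_fst (n := 1) j (by omega) hF
    have h3 := hasFDerivAt_parametric_intervalIntegral
      (F := fun p s => iteratedFDeriv ℝ j (fun q => F q s) p) (by exact_mod_cast h2) a b p
    simp only [iteratedFDeriv_succ_eq_comp_left, Function.comp_apply]
    rw [h1, h3.fderiv]
    have h4 := contDiff_fderiv_fst (F := fun p s => iteratedFDeriv ℝ j (fun q => F q s) p)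
      (m := 1) (n := 0) le_rfl h2
    have h5 : IntervalIntegrable (fun s => fderiv ℝ (fun p => iteratedFDeriv ℝ j (fun q => F q s) p)
        p) volume a b := (h4.continuous.comp (Continuous.prodMk_right p)).intervalIntegrable _ _
    exact (ContinuousLinearMap.intervalIntegral_comp_comm
      (continuousMultilinearCurryLeftEquiv ℝ (fun _ : Fin (j + 1) => P)
        G).symm.toContinuousLinearEquiv.toContinuousLinearMap h5).symm

end ParametricIntegral

end SGDExpansion

namespace SGDExpansion

open Filter Topology
open scoped NNReal

universe w

/-! ### Existence and joint smoothness of the flow of a bounded Lipschitz field -/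

section Flow

/-- `X` is the global flow of the autonomous vector field `V`. -/
structure IsFlow {E : Type*} [NormedAddCommGroup E] [NormedSpace ℝ E] (V : E → E)
    (X : E → ℝ → E) : Prop where
  zero : ∀ x, X x 0 = x
  hasDerivAt : ∀ x t, HasDerivAt (X x) (V (X x t)) t

variable {E : Type w} [NormedAddCommGroup E] [NormedSpace ℝ E]
  {V : E → E} {K L : ℝ≥0}

theorem exists_isFlow [CompleteSpace E] (hK : LipschitzWith K V) (hL : ∀ x, ‖V x‖ ≤ L) : ∃ X, IsFlow V X := by
  have hloc : ∀ (x : E) (m : ℕ), ∃ α : ℝ → E, α 0 = x ∧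
      ∀ t ∈ Ioo (-(m + 1 : ℝ)) (m + 1), HasDerivAt α (V (α t)) t := by
    intro x m
    have h0 : (0 : ℝ) ∈ Icc (-(m + 1 : ℝ)) (m + 1) := ⟨by linarith [m.cast_nonneg (α := ℝ)], by positivity⟩
    -- Since `V` is bounded by `L` everywhere, the ball of radius `L * (m + 1)` contains the
    -- solution on the whole interval, so there is no restriction on the time of existence.
    have hp : IsPicardLindelof (fun _ => V) (⟨0, h0⟩ : Icc (-(m + 1 : ℝ)) (m + 1)) x
        (L * (m + 1)) 0 L K :=
      { lipschitzOnWith := fun _ _ => hK.lipschitzOnWith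
        continuousOn := fun _ _ => continuousOn_const
        norm_le := fun _ _ x _ => hL x
        mul_max_le := by simp }
    obtain ⟨α, h1, h2⟩ := hp.exists_eq_forall_mem_Icc_hasDerivWithinAt₀
    exact ⟨α, h1, fun t ht => (h2 t (Ioo_subset_Icc_self ht)).hasDerivAt (Icc_mem_nhds ht.1 ht.2)⟩
  choose α hα0 hα using hloc
  have huniq : ∀ x (m m' : ℕ), m ≤ m' → EqOn (α x m) (α x m') (Ioo (-(m + 1 : ℝ)) (m + 1)) := by
    intro x m m' hm
    have hm' : (m : ℝ) ≤ m' := by exact_mod_cast hm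
    refine ODE_solution_unique_of_mem_Ioo (v := fun _ => V) (s := fun _ => univ) (K := K)
      (fun _ _ => hK.lipschitzOnWith) (t₀ := 0) ⟨by linarith [m.cast_nonneg (α := ℝ)], by positivity⟩
      (fun t ht => ⟨hα x m t ht, trivial⟩)
      (fun t ht => ⟨hα x m' t ⟨by linarith [ht.1], by linarith [ht.2]⟩, trivial⟩) ?_
    rw [hα0, hα0]
  -- The local solutions agree where they overlap, so the index may depend on `t`. Near a given `t`
  -- the single index `⌈|t|⌉₊ + 1` serves for all times.
  refine ⟨fun x t => α x ⌈|t|⌉₊ t, fun x => hα0 x _, fun x t => ?_⟩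
  have hmem : ∀ s : ℝ, s ∈ Ioo (-((⌈|s|⌉₊ : ℝ) + 1)) ((⌈|s|⌉₊ : ℝ) + 1) := fun s => by
    have := Nat.le_ceil |s|
    exact abs_lt.1 (by linarith)
  have heq : ∀ s : ℝ, |s| < |t| + 1 → α x ⌈|s|⌉₊ s = α x (⌈|t|⌉₊ + 1) s := fun s hs => by
    refine huniq x _ _ ?_ (hmem s)
    rw [Nat.ceil_le]
    push_cast
    linarith [Nat.le_ceil |t|]
  have hd : HasDerivAt (α x (⌈|t|⌉₊ + 1)) (V (α x (⌈|t|⌉₊ + 1) t)) t := by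
    refine hα x _ t ?_
    have := hmem t
    push_cast
    exact ⟨by linarith [this.1], by linarith [this.2]⟩
  simp only [heq t (by linarith)]
  refine hd.congr_of_eventuallyEq ?_
  have : ∀ᶠ s in 𝓝 t, |s| < |t| + 1 := continuous_abs.continuousAt.eventually_lt_const (by linarith)
  filter_upwards [this] with s hs using heq s hs

theorem IsFlow.unique {X : E → ℝ → E} (hX : IsFlow V X) (hK : LipschitzWith K V) {x : E}
    {α : ℝ → E} (h0 : α 0 = x) (hα : ∀ t, HasDerivAt α (V (α t)) t) : α = X x :=
  ODE_solution_unique_univ (v := fun _ => V) (s := fun _ => univ) (K := K) (t₀ := 0)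
    (fun _ => hK.lipschitzOnWith) (fun t => ⟨hα t, trivial⟩)
    (fun t => ⟨hX.hasDerivAt x t, trivial⟩) (by rw [h0, hX.zero])

theorem IsFlow.add {X : E → ℝ → E} (hX : IsFlow V X) (hK : LipschitzWith K V) (x : E) (s t : ℝ) :
    X x (s + t) = X (X x s) t := by
  refine congrFun (hX.unique hK (α := fun t => X x (s + t)) (by simp) fun t => ?_) t
  have := (hX.hasDerivAt x (s + t)).scomp t ((hasDerivAt_id t).const_add s)
  simpa [Function.comp_def] using this

theorem IsFlow.norm_sub_le {X : E → ℝ → E} (hX : IsFlow V X) (hL : ∀ x, ‖V x‖ ≤ L) (x : E)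
    (t : ℝ) : ‖X x t - x‖ ≤ L * |t| := by
  have := convex_univ.norm_image_sub_le_of_norm_hasDerivWithin_le
    (fun s (_ : s ∈ univ) => (hX.hasDerivAt x s).hasDerivWithinAt) (fun s _ => hL _)
    (mem_univ 0) (mem_univ t)
  simpa [hX.zero] using this

/-- The primitive vanishing at `0`, as an operator on continuous functions on `[0, 1]`. -/
noncomputable def primitive (E : Type*) [NormedAddCommGroup E] [NormedSpace ℝ E] :
    C(Icc (0 : ℝ) 1, E) →L[ℝ] C(Icc (0 : ℝ) 1, E) :=
  LinearMap.mkContinuous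
    { toFun := fun c => ⟨fun s => ∫ τ in (0 : ℝ)..s, c (projIcc 0 1 zero_le_one τ), by
        have : Continuous fun s : ℝ => ∫ τ in (0 : ℝ)..s, c (projIcc 0 1 zero_le_one τ) :=
          intervalIntegral.continuous_primitive
            (fun a b => (c.continuous.comp continuous_projIcc).intervalIntegrable a b) 0
        exact this.comp continuous_subtype_val⟩
      map_add' := fun c c' => by
        ext s
        exact intervalIntegral.integral_add
          ((c.continuous.comp continuous_projIcc).intervalIntegrable _ _)
          ((c'.continuous.comp continuous_projIcc).intervalIntegrable _ _)
      map_smul' := fun r c => by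
        ext s
        exact intervalIntegral.integral_smul r _ } 1
    (fun c => by
      rw [ContinuousMap.norm_le _ (by positivity)]
      intro s
      refine (intervalIntegral.norm_integral_le_of_norm_le_const
        fun τ _ => c.norm_coe_le_norm (projIcc 0 1 zero_le_one τ)).trans ?_
      rw [sub_zero, abs_of_nonneg s.2.1, one_mul]
      exact mul_le_of_le_one_right (norm_nonneg _) s.2.2)

/-- Rescaling time to `[0,1]` turns `t` into a parameter: the curve `s ↦ X x (t s)` solves `c = x +
t ∫ V ∘ c`. At `t = 0` the linearization in `c` is the identity, so the implicit function theorem in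
`C([0,1],E)` yields smoothness in `(x,t)` jointly. -/
theorem IsFlow.contDiffAt_zero [CompleteSpace E] {X : E → ℝ → E} (hX : IsFlow V X) (hL : ∀ x, ‖V x‖ ≤ L) {n : ℕ}
    (hn : n ≠ 0) (hV : ContDiff ℝ n V) (x₀ : E) :
    ContDiffAt ℝ n (fun p : E × ℝ => X p.1 p.2) (x₀, 0) := by
  let VC : C(E, E) := ⟨V, hV.continuous⟩
  let const : E →L[ℝ] C(Icc (0 : ℝ) 1, E) :=
    LinearMap.mkContinuous ⟨⟨ContinuousMap.const _, fun _ _ => rfl⟩, fun _ _ => rfl⟩ 1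
      (fun x => by rw [ContinuousMap.norm_le _ (by positivity), one_mul]; exact fun s => le_rfl)
  have hconst : ∀ x s, const x s = x := fun _ _ => rfl
  let Φ : (E × ℝ) × C(Icc (0 : ℝ) 1, E) → C(Icc (0 : ℝ) 1, E) := fun v =>
    v.2 - const v.1.1 - v.1.2 • primitive E (VC.comp v.2)
  have hcomp : ContDiff ℝ n (fun v : (E × ℝ) × C(Icc (0 : ℝ) 1, E) => VC.comp v.2) :=
    (contDiff_postcomp n VC hV).comp contDiff_snd
  have hΦ : ContDiff ℝ n Φ := by
    refine (contDiff_snd.sub (const.contDiff.comp (contDiff_fst.comp contDiff_fst))).sub ?_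
    exact (contDiff_snd.comp contDiff_fst).smul ((primitive E).contDiff.comp hcomp)
  let u : (E × ℝ) × C(Icc (0 : ℝ) 1, E) := ((x₀, 0), const x₀)
  have hn' : (n : WithTop ℕ∞) ≠ 0 := by exact_mod_cast hn
  have hinv : (fderiv ℝ Φ u ∘L .inr ℝ (E × ℝ) C(Icc (0 : ℝ) 1, E)).IsInvertible := by
    have h1 : HasFDerivAt (fun c => Φ ((x₀, 0), c))
        (fderiv ℝ Φ u ∘L .inr ℝ (E × ℝ) C(Icc (0 : ℝ) 1, E)) (const x₀) :=
      HasFDerivAt.comp (const x₀) (g := Φ)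
        ((hΦ.differentiable hn').differentiableAt (x := u)).hasFDerivAt (hasFDerivAt_prodMk_right _ _)
    have h2 : HasFDerivAt (fun c => Φ ((x₀, 0), c))
        (ContinuousLinearMap.id ℝ C(Icc (0 : ℝ) 1, E)) (const x₀) := by
      have : (fun c => Φ ((x₀, 0), c)) = fun c => c - const x₀ := by
        funext c
        simp [Φ]
      rw [this]
      exact (hasFDerivAt_id _).sub_const _
    rw [h1.unique h2]
    exact ⟨ContinuousLinearEquiv.refl ℝ _, rfl⟩
  let c : E × ℝ → C(Icc (0 : ℝ) 1, E) := fun p => ⟨fun s => X p.1 (p.2 * s), by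
    have : Continuous (X p.1) := continuous_iff_continuousAt.2 fun t => (hX.hasDerivAt _ t).continuousAt
    fun_prop⟩
  -- The implicit function only describes zeros near the base point. The bound on `V` shows that the
  -- rescaled trajectories converge uniformly to the constant curve, so they are the zeros it
  -- describes.
  have hc : Tendsto (fun p => (p, c p)) (𝓝 (x₀, (0 : ℝ))) (𝓝 u) := by
    refine tendsto_id.prodMk_nhds ?_
    rw [tendsto_iff_norm_sub_tendsto_zero]
    have hb : Tendsto (fun p : E × ℝ => L * |p.2| + ‖p.1 - x₀‖) (𝓝 (x₀, 0)) (𝓝 0) := by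
      have : Continuous (fun p : E × ℝ => L * |p.2| + ‖p.1 - x₀‖) := by fun_prop
      simpa using this.tendsto (x₀, 0)
    refine squeeze_zero (fun _ => norm_nonneg _) (fun p => ?_) hb
    rw [ContinuousMap.norm_le _ (by positivity)]
    intro s
    have h1 := hX.norm_sub_le hL p.1 (p.2 * s)
    have h2 : (L : ℝ) * |p.2 * s| ≤ L * |p.2| := by
      rw [abs_mul, abs_of_nonneg s.2.1]
      exact mul_le_mul_of_nonneg_left (mul_le_of_le_one_right (abs_nonneg _) s.2.2) L.2
    calc ‖(c p - const x₀) s‖ = ‖(X p.1 (p.2 * s) - p.1) + (p.1 - x₀)‖ := by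
          simp [c, hconst]
      _ ≤ _ := (norm_add_le _ _).trans (by linarith)
  have hzero : ∀ p, Φ (p, c p) = Φ u := by
    intro p
    have hu : Φ u = 0 := by simp [Φ, u]
    rw [hu]
    ext s
    have h1 : ∀ τ : ℝ, HasDerivAt (fun τ => X p.1 (p.2 * τ)) (p.2 • V (X p.1 (p.2 * τ))) τ := by
      intro τ
      have := (hX.hasDerivAt p.1 (p.2 * τ)).scomp τ ((hasDerivAt_id τ).const_mul p.2)
      simpa [Function.comp_def] using this
    have hcont : Continuous (fun τ => X p.1 (p.2 * τ)) :=
      continuous_iff_continuousAt.2 fun t => (h1 t).continuousAt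
    have h2 := intervalIntegral.integral_eq_sub_of_hasDerivAt (a := 0) (b := s)
      (fun τ _ => h1 τ)
      (((hV.continuous.comp hcont).const_smul p.2).intervalIntegrable _ _)
    have h3 : ∫ τ in (0 : ℝ)..s, V (X p.1 (p.2 * (projIcc (0 : ℝ) 1 zero_le_one τ : ℝ))) =
        ∫ τ in (0 : ℝ)..s, V (X p.1 (p.2 * τ)) := by
      refine intervalIntegral.integral_congr fun τ hτ => ?_
      rw [uIcc_of_le s.2.1] at hτ
      rw [projIcc_of_mem _ ⟨hτ.1, hτ.2.trans s.2.2⟩]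
    have h4 : (primitive E (VC.comp (c p))) s = ∫ τ in (0 : ℝ)..s, V (X p.1 (p.2 * τ)) := by
      rw [← h3]; rfl
    rw [intervalIntegral.integral_smul] at h2
    simp only [mul_zero, hX.zero] at h2
    have h5 : Φ (p, c p) s = X p.1 (p.2 * s) - p.1 - p.2 • (primitive E (VC.comp (c p))) s := rfl
    rw [h5, h4, h2]
    simp
  have hev := hc.eventually (hΦ.contDiffAt.eventually_apply_eq_iff_implicitFunction hn' hinv)
  have himp := hΦ.contDiffAt.contDiffAt_implicitFunction hn' hinv
  have heval : ContDiff ℝ n (fun c : C(Icc (0 : ℝ) 1, E) => c ⟨1, by simp⟩) :=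
    ContinuousLinearMap.contDiff (ContinuousMap.evalCLM ℝ (⟨1, by simp⟩ : Icc (0 : ℝ) 1) :
      C(Icc (0 : ℝ) 1, E) →L[ℝ] E)
  refine (heval.contDiffAt.comp (x₀, (0 : ℝ)) himp).congr_of_eventuallyEq ?_
  filter_upwards [hev] with p hp
  have := hp.1 (hzero p)
  simp only [Function.comp]
  rw [this]
  simp [c]

/-- For fixed `x₀` the set of times of smoothness is open, and it is closed because of the identity
`X x t = X (X x t₁) (t - t₁)` with `t₁` a good time close to `t`. It contains `0`, so it is all of
`ℝ`. -/
theorem IsFlow.contDiff [CompleteSpace E] {X : E → ℝ → E} (hX : IsFlow V X) (hK : LipschitzWith K V)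
    (hL : ∀ x, ‖V x‖ ≤ L) {n : ℕ} (hn : n ≠ 0) (hV : ContDiff ℝ n V) :
    ContDiff ℝ n (fun p : E × ℝ => X p.1 p.2) := by
  rw [contDiff_iff_contDiffAt]
  rintro ⟨x₀, t₀⟩
  set s : Set ℝ := {t | ContDiffAt ℝ n (fun p : E × ℝ => X p.1 p.2) (x₀, t)} with hs
  have hopen : IsOpen s := by
    rw [isOpen_iff_mem_nhds]
    intro t ht
    have h1 := ContDiffAt.eventually
      (show ContDiffAt ℝ n (fun p : E × ℝ => X p.1 p.2) (x₀, t) from ht) (by simp)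
    exact (Continuous.prodMk_right x₀).continuousAt.eventually h1
  have hclosed : IsClosed s := by
    rw [← closure_subset_iff_isClosed]
    intro t ht
    have hcX : Continuous (X x₀) := continuous_iff_continuousAt.2 fun t => (hX.hasDerivAt _ t).continuousAt
    have h1 := (hX.contDiffAt_zero hL hn hV (X x₀ t)).eventually (by simp)
    have h2 : Tendsto (fun t₁ => (X x₀ t₁, t - t₁)) (𝓝 t) (𝓝 (X x₀ t, 0)) := by
      have : Continuous (fun t₁ => (X x₀ t₁, t - t₁)) := by fun_prop
      simpa using this.tendsto t
    obtain ⟨t₁, ht₁, ht₂⟩ := (mem_closure_iff_frequently.1 ht).and_eventually (h2.eventually h1) |>.exists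
    have h3 : ContDiffAt ℝ n (fun p : E × ℝ => (X p.1 t₁, p.2 - t₁)) (x₀, t) := by
      refine ContDiffAt.prodMk ?_ (contDiffAt_snd.sub contDiffAt_const)
      exact ContDiffAt.comp (x₀, t) (g := fun p : E × ℝ => X p.1 p.2) (f := fun p : E × ℝ => (p.1, t₁)) ht₁
        (contDiffAt_fst.prodMk contDiffAt_const)
    have h4 := ContDiffAt.comp (x₀, t) (g := fun p : E × ℝ => X p.1 p.2) ht₂ h3
    refine h4.congr_of_eventuallyEq (Eventually.of_forall fun p => ?_)
    simp [← hX.add hK]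
  have h0 : s.Nonempty := ⟨0, hX.contDiffAt_zero hL hn hV x₀⟩
  have : t₀ ∈ s := by rw [IsClopen.eq_univ ⟨hclosed, hopen⟩ h0]; trivial
  exact this

end Flow

end SGDExpansion

namespace SGDExpansion

open Filter Topology
open scoped NNReal

set_option maxSynthPendingDepth 4

/-! ### First and second order operators: regularity, commutation with time derivatives, decay -/

section Operators

variable {E : Type*} [NormedAddCommGroup E] [NormedSpace ℝ E]

/-- The first order operator `v ↦ V · ∇v`. -/
noncomputable def drift (V : E → E) (v : E → ℝ) (x : E) : ℝ := fderiv ℝ v x (V x)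

/-- The second order operator `v ↦ A : ∇²v`. -/
noncomputable def diffusion (A : E → (E →L[ℝ] E →L[ℝ] ℝ) →L[ℝ] ℝ) (v : E → ℝ) (x : E) : ℝ :=
  A x (fderiv ℝ (fderiv ℝ v) x)

theorem contDiff_slice {F : Type*} [NormedAddCommGroup F] [NormedSpace ℝ F] {m : WithTop ℕ∞}
    {w : E → ℝ → F} (hw : ContDiff ℝ m (fun p : E × ℝ => w p.1 p.2)) (t : ℝ) :
    ContDiff ℝ m (fun x => w x t) := hw.comp (contDiff_prodMk_left t)

theorem contDiff_time {F : Type*} [NormedAddCommGroup F] [NormedSpace ℝ F] {m : WithTop ℕ∞}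
    {w : E → ℝ → F} (hw : ContDiff ℝ m (fun p : E × ℝ => w p.1 p.2)) (x : E) :
    ContDiff ℝ m (w x) := hw.comp (contDiff_prodMk_right x)

theorem contDiff_drift {m : ℕ} {V : E → E} (hV : ContDiff ℝ m V) {w : E → ℝ → ℝ}
    (hw : ContDiff ℝ (m + 1 : ℕ) (fun p : E × ℝ => w p.1 p.2)) :
    ContDiff ℝ m (fun p : E × ℝ => drift V (fun y => w y p.2) p.1) :=
  (contDiff_fderiv_fst le_rfl hw).clm_apply (hV.comp contDiff_fst)

theorem contDiff_diffusion {m : ℕ} {A : E → (E →L[ℝ] E →L[ℝ] ℝ) →L[ℝ] ℝ} (hA : ContDiff ℝ m A)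
    {w : E → ℝ → ℝ} (hw : ContDiff ℝ (m + 2 : ℕ) (fun p : E × ℝ => w p.1 p.2)) :
    ContDiff ℝ m (fun p : E × ℝ => diffusion A (fun y => w y p.2) p.1) :=
  (hA.comp contDiff_fst).clm_apply (contDiff_fderiv_fst (F := fun y t => fderiv ℝ (fun z => w z t) y)
    le_rfl (contDiff_fderiv_fst le_rfl hw))

theorem deriv_time_eq {F : Type*} [NormedAddCommGroup F] [NormedSpace ℝ F] {w : E → ℝ → F}
    (hw : Differentiable ℝ (fun p : E × ℝ => w p.1 p.2)) (x : E) (t : ℝ) :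
    deriv (w x) t = fderiv ℝ (fun p : E × ℝ => w p.1 p.2) (x, t) (0, 1) := by
  have h1 : HasFDerivAt (w x) ((fderiv ℝ (fun p : E × ℝ => w p.1 p.2) (x, t)).comp (.inr ℝ E ℝ)) t :=
    HasFDerivAt.comp t (g := fun p : E × ℝ => w p.1 p.2) (f := fun s => (x, s))
      hw.differentiableAt.hasFDerivAt (hasFDerivAt_prodMk_right _ _)
  simpa using h1.hasDerivAt.deriv

theorem fderiv_slice_eq {F : Type*} [NormedAddCommGroup F] [NormedSpace ℝ F] {w : E → ℝ → F}
    (hw : Differentiable ℝ (fun p : E × ℝ => w p.1 p.2)) (x : E) (t : ℝ) :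
    fderiv ℝ (fun y => w y t) x =
      (fderiv ℝ (fun p : E × ℝ => w p.1 p.2) (x, t)).comp (.inl ℝ E ℝ) :=
  (HasFDerivAt.comp x (g := fun p : E × ℝ => w p.1 p.2) (f := fun y => (y, t))
      hw.differentiableAt.hasFDerivAt (hasFDerivAt_prodMk_left _ _)).fderiv

theorem contDiff_deriv_time {F : Type*} [NormedAddCommGroup F] [NormedSpace ℝ F] {w : E → ℝ → F}
    {m : ℕ} (hw : ContDiff ℝ (m + 1 : ℕ) (fun p : E × ℝ => w p.1 p.2)) :
    ContDiff ℝ m (fun p : E × ℝ => deriv (w p.1) p.2) := by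
  simp only [deriv_time_eq (hw.differentiable (by simp))]
  exact (hw.fderiv_right (m := m) (by norm_cast)).clm_apply contDiff_const

/-- Symmetry of the second derivative of `w` on the product, applied to a spatial direction and the
time direction. -/
theorem hasDerivAt_fderiv_slice {F : Type*} [NormedAddCommGroup F] [NormedSpace ℝ F]
    {w : E → ℝ → F} (hw : ContDiff ℝ 2 (fun p : E × ℝ => w p.1 p.2)) (x : E) (t : ℝ) :
    HasDerivAt (fun t => fderiv ℝ (fun y => w y t) x) (fderiv ℝ (fun y => deriv (w y) t) x) t := by
  set W : E × ℝ → F := fun p => w p.1 p.2 with hW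
  have hd : Differentiable ℝ W := hw.differentiable (by simp)
  have hd2 : Differentiable ℝ (fderiv ℝ W) :=
    (hw.fderiv_right (m := 1) (by norm_num)).differentiable (by simp)
  have hsymm : IsSymmSndFDerivAt ℝ W (x, t) := hw.contDiffAt.isSymmSndFDerivAt (by simp)
  simp only [fderiv_slice_eq hd, deriv_time_eq hd]
  have h1 : HasDerivAt (fun s => fderiv ℝ W (x, s)) (fderiv ℝ (fderiv ℝ W) (x, t) (0, 1)) t := by
    have := (hd2 (x, t)).hasFDerivAt.comp t (hasFDerivAt_prodMk_right x t)
    simpa [Function.comp_def] using this.hasDerivAt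
  have h2 := h1.clm_comp (hasDerivAt_const t (ContinuousLinearMap.inl ℝ E ℝ))
  convert! h2 using 1
  ext h
  have h3 : HasFDerivAt (fun y => fderiv ℝ W (y, t) (0, 1))
      ((ContinuousLinearMap.apply ℝ F ((0 : E), (1 : ℝ))).comp
        ((fderiv ℝ (fderiv ℝ W) (x, t)).comp (.inl ℝ E ℝ))) x :=
    (ContinuousLinearMap.apply ℝ F ((0 : E), (1 : ℝ))).hasFDerivAt.comp x
      ((hd2 (x, t)).hasFDerivAt.comp x (hasFDerivAt_prodMk_left x t))
  rw [h3.fderiv]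
  simpa using hsymm (h, 0) (0, 1)

theorem hasDerivAt_drift {w : E → ℝ → ℝ} (hw : ContDiff ℝ 2 (fun p : E × ℝ => w p.1 p.2))
    (V : E → E) (x : E) (t : ℝ) :
    HasDerivAt (fun t => drift V (fun y => w y t) x) (drift V (fun y => deriv (w y) t) x) t := by
  have := (hasDerivAt_fderiv_slice hw x t).clm_apply (hasDerivAt_const t (V x))
  simpa [drift] using this

theorem hasDerivAt_diffusion {w : E → ℝ → ℝ} (hw : ContDiff ℝ 3 (fun p : E × ℝ => w p.1 p.2))
    (A : E → (E →L[ℝ] E →L[ℝ] ℝ) →L[ℝ] ℝ) (x : E) (t : ℝ) :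
    HasDerivAt (fun t => diffusion A (fun y => w y t) x)
      (diffusion A (fun y => deriv (w y) t) x) t := by
  have h0 : ContDiff ℝ (2 : ℕ) (fun p : E × ℝ => fderiv ℝ (fun y => w y p.2) p.1) :=
    contDiff_fderiv_fst (m := 3) (by norm_num) (by exact_mod_cast hw)
  have h1 := hasDerivAt_fderiv_slice (w := fun y t => fderiv ℝ (fun z => w z t) y)
    (by exact_mod_cast h0) x t
  have h2 : (fun y => deriv (fun s => fderiv ℝ (fun z => w z s) y) t) =
      fderiv ℝ (fun z => deriv (w z) t) :=
    funext fun y => (hasDerivAt_fderiv_slice (hw.of_le (by norm_num)) y t).deriv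
  rw [h2] at h1
  have := (hasDerivAt_const t (A x)).clm_apply h1
  simpa [diffusion] using this

theorem contDiff_iteratedDeriv_time {m : ℕ} (j : ℕ) : ∀ {w : E → ℝ → ℝ},
    ContDiff ℝ (m + j : ℕ) (fun p : E × ℝ => w p.1 p.2) →
    ContDiff ℝ m (fun p : E × ℝ => iteratedDeriv j (w p.1) p.2) := by
  induction j with
  | zero => intro w hw; simpa using hw
  | succ j ih =>
    intro w hw
    simp only [iteratedDeriv_succ']
    exact ih (w := fun x t => deriv (w x) t) (contDiff_deriv_time (m := m + j) hw)

theorem iteratedDeriv_drift (V : E → E) (x : E) (j : ℕ) : ∀ {w : E → ℝ → ℝ},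
    ContDiff ℝ (j + 1 : ℕ) (fun p : E × ℝ => w p.1 p.2) → ∀ t,
    iteratedDeriv j (fun t => drift V (fun y => w y t) x) t =
      drift V (fun y => iteratedDeriv j (w y) t) x := by
  induction j with
  | zero => intro w _ t; simp
  | succ j ih =>
    intro w hw t
    have h1 : deriv (fun t => drift V (fun y => w y t) x) =
        fun t => drift V (fun y => deriv (w y) t) x :=
      funext fun t => (hasDerivAt_drift (hw.of_le (by norm_cast; omega)) V x t).deriv
    simp only [iteratedDeriv_succ']
    rw [h1]
    exact ih (contDiff_deriv_time hw) t

theorem iteratedDeriv_diffusion (A : E → (E →L[ℝ] E →L[ℝ] ℝ) →L[ℝ] ℝ) (x : E) (j : ℕ) :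
    ∀ {w : E → ℝ → ℝ},
    ContDiff ℝ (j + 2 : ℕ) (fun p : E × ℝ => w p.1 p.2) → ∀ t,
    iteratedDeriv j (fun t => diffusion A (fun y => w y t) x) t =
      diffusion A (fun y => iteratedDeriv j (w y) t) x := by
  induction j with
  | zero => intro w _ t; simp
  | succ j ih =>
    intro w hw t
    have h1 : deriv (fun t => diffusion A (fun y => w y t) x) =
        fun t => diffusion A (fun y => deriv (w y) t) x :=
      funext fun t => (hasDerivAt_diffusion (hw.of_le (by norm_cast; omega)) A x t).deriv
    simp only [iteratedDeriv_succ']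
    rw [h1]
    exact ih (contDiff_deriv_time (m := j + 2) hw) t

/-- `w` is jointly `C^m`, and its spatial derivatives of order `m₀, …, m` decay exponentially with
rate `a` on the ball of radius `r`. -/
structure Decay (r a c : ℝ) (m₀ m : ℕ) (w : E → ℝ → ℝ) : Prop where
  contDiff : ContDiff ℝ m (fun p : E × ℝ => w p.1 p.2)
  bound : ∀ x ∈ ball (0 : E) r, ∀ t : ℝ, 0 ≤ t → ∀ j, m₀ ≤ j → j ≤ m →
    ‖iteratedFDeriv ℝ j (fun y => w y t) x‖ ≤ c * Real.exp (-a * t)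

variable {r a c c' M : ℝ} {m m' m₀ m₀' : ℕ} {w w' : E → ℝ → ℝ}

theorem Decay.mono (h : Decay r a c m₀ m w) (hc : c ≤ c') (hm : m' ≤ m) (hm₀ : m₀ ≤ m₀') :
    Decay r a c' m₀' m' w where
  contDiff := h.contDiff.of_le (by exact_mod_cast hm)
  bound x hx t ht j h1 h2 := (h.bound x hx t ht j (hm₀.trans h1) (h2.trans hm)).trans
    (mul_le_mul_of_nonneg_right hc (Real.exp_pos _).le)

theorem Decay.add (h : Decay r a c m₀ m w) (h' : Decay r a c' m₀ m w') :
    Decay r a (c + c') m₀ m (fun x t => w x t + w' x t) where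
  contDiff := h.contDiff.add h'.contDiff
  bound x hx t ht j h1 h2 := by
    have e : iteratedFDeriv ℝ j (fun y => w y t + w' y t) x = _ :=
      iteratedFDeriv_add_apply
        ((contDiff_slice h.contDiff t).of_le (by exact_mod_cast h2)).contDiffAt
        ((contDiff_slice h'.contDiff t).of_le (by exact_mod_cast h2)).contDiffAt
    rw [e, add_mul]
    exact (norm_add_le _ _).trans (add_le_add (h.bound x hx t ht j h1 h2)
      (h'.bound x hx t ht j h1 h2))

theorem Decay.const_mul (h : Decay r a c m₀ m w) (s : ℝ) :
    Decay r a (|s| * c) m₀ m (fun x t => s * w x t) where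
  contDiff := contDiff_const.mul h.contDiff
  bound x hx t ht j h1 h2 := by
    have e : iteratedFDeriv ℝ j (fun y => s * w y t) x = s • iteratedFDeriv ℝ j (fun y => w y t) x :=
      iteratedFDeriv_const_smul_apply (a := s) (f := fun y => w y t)
        ((contDiff_slice h.contDiff t).of_le (by exact_mod_cast h2)).contDiffAt
    rw [e, norm_smul, Real.norm_eq_abs, mul_assoc]
    exact mul_le_mul_of_nonneg_left (h.bound x hx t ht j h1 h2) (abs_nonneg _)

theorem norm_iteratedFDeriv_clm_apply_le_of_bound {F G : Type*} [NormedAddCommGroup F]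
    [NormedSpace ℝ F] [NormedAddCommGroup G] [NormedSpace ℝ G] {f : E → F →L[ℝ] G} {g : E → F}
    {n : ℕ} {x : E} {c₁ c₂ : ℝ} (hf : ContDiff ℝ n f) (hg : ContDiff ℝ n g)
    (h1 : ∀ i ≤ n, ‖iteratedFDeriv ℝ i f x‖ ≤ c₁) (h2 : ∀ i ≤ n, ‖iteratedFDeriv ℝ i g x‖ ≤ c₂) :
    ‖iteratedFDeriv ℝ n (fun y => f y (g y)) x‖ ≤ 2 ^ n * (c₁ * c₂) := by
  have hc₁ : 0 ≤ c₁ := (norm_nonneg _).trans (h1 0 (Nat.zero_le _))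
  refine (norm_iteratedFDeriv_clm_apply hf hg x le_rfl).trans ?_
  calc _ ≤ ∑ i ∈ Finset.range (n + 1), (n.choose i : ℝ) * (c₁ * c₂) := by
        refine Finset.sum_le_sum fun i hi => ?_
        rw [mul_assoc]
        refine mul_le_mul_of_nonneg_left ?_ (Nat.cast_nonneg _)
        exact mul_le_mul (h1 i (by simpa [Nat.lt_succ_iff] using hi)) (h2 _ (Nat.sub_le _ _))
          (norm_nonneg _) hc₁
    _ = 2 ^ n * (c₁ * c₂) := by
        rw [← Finset.sum_mul]
        congr 1
        exact_mod_cast Nat.sum_range_choose n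

/-- The operator only reads the gradient of `w`, so decay of the derivatives of order at least one
gives decay of the image itself. This is why the lower order passes from `1` to `0`. -/
theorem Decay.drift (h : Decay r a c 1 (m + 1) w) {V : E → E} (hV : ContDiff ℝ m V)
    (hM : ∀ x ∈ ball (0 : E) r, ∀ j ≤ m, ‖iteratedFDeriv ℝ j V x‖ ≤ M) (hM0 : 0 ≤ M) (hc : 0 ≤ c) :
    Decay r a (2 ^ m * M * c) 0 m (fun x t => drift V (fun y => w y t) x) where
  contDiff := contDiff_drift hV h.contDiff
  bound x hx t ht j _ hj := by
    have hs := contDiff_slice h.contDiff t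
    have h1 : ContDiff ℝ m (fderiv ℝ (fun y => w y t)) := hs.fderiv_right (by norm_cast)
    refine (norm_iteratedFDeriv_clm_apply_le_of_bound (c₁ := c * Real.exp (-a * t)) (c₂ := M)
      (h1.of_le (by exact_mod_cast hj)) (hV.of_le (by exact_mod_cast hj)) (fun i hi => ?_)
      (fun i hi => hM x hx i (hi.trans hj))).trans ?_
    · rw [norm_iteratedFDeriv_fderiv]
      exact h.bound x hx t ht _ (by omega) (by omega)
    · have : (2 : ℝ) ^ j ≤ 2 ^ m := pow_le_pow_right₀ (by norm_num) hj
      calc _ ≤ 2 ^ m * (c * Real.exp (-a * t) * M) :=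
            mul_le_mul_of_nonneg_right this (by positivity)
        _ = _ := by ring

theorem Decay.diffusion (h : Decay r a c 1 (m + 2) w) {A : E → (E →L[ℝ] E →L[ℝ] ℝ) →L[ℝ] ℝ}
    (hA : ContDiff ℝ m A)
    (hM : ∀ x ∈ ball (0 : E) r, ∀ j ≤ m, ‖iteratedFDeriv ℝ j A x‖ ≤ M) (hM0 : 0 ≤ M) (hc : 0 ≤ c) :
    Decay r a (2 ^ m * M * c) 0 m (fun x t => diffusion A (fun y => w y t) x) where
  contDiff := contDiff_diffusion hA h.contDiff
  bound x hx t ht j _ hj := by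
    have hs := contDiff_slice h.contDiff t
    have h1 : ContDiff ℝ (m + 1 : ℕ) (fderiv ℝ (fun y => w y t)) := hs.fderiv_right (by norm_cast)
    have h2 : ContDiff ℝ m (fderiv ℝ (fderiv ℝ (fun y => w y t))) := h1.fderiv_right (by norm_cast)
    refine (norm_iteratedFDeriv_clm_apply_le_of_bound (c₁ := M) (c₂ := c * Real.exp (-a * t))
      (hA.of_le (by exact_mod_cast hj)) (h2.of_le (by exact_mod_cast hj))
      (fun i hi => hM x hx i (hi.trans hj)) (fun i hi => ?_)).trans ?_
    · rw [norm_iteratedFDeriv_fderiv, norm_iteratedFDeriv_fderiv]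
      exact h.bound x hx t ht _ (by omega) (by omega)
    · have : (2 : ℝ) ^ j ≤ 2 ^ m := pow_le_pow_right₀ (by norm_num) hj
      calc _ ≤ 2 ^ m * (M * (c * Real.exp (-a * t))) :=
            mul_le_mul_of_nonneg_right this (by positivity)
        _ = _ := by ring

end Operators

end SGDExpansion

namespace SGDExpansion

open Filter Topology
open scoped NNReal

set_option maxSynthPendingDepth 4

universe w

/-! ### Exponential decay of the spatial derivatives of a dissipative flow -/

section FlowDecay

/-- Exchanging derivatives in `w` directly would require joint regularity of order `j + 1`. Writing
`w` as its initial value plus the time integral of `g`, and differentiating under the integral,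
needs only order `j`. -/
theorem hasDerivAt_iteratedFDeriv_slice {P G : Type w} [NormedAddCommGroup P] [NormedSpace ℝ P]
    [ProperSpace P] [NormedAddCommGroup G] [NormedSpace ℝ G] [CompleteSpace G]
    {w g : P → ℝ → G} {j : ℕ} (hw : ContDiff ℝ j (fun x => w x 0))
    (hg : ContDiff ℝ j (fun p : P × ℝ => g p.1 p.2))
    (hd : ∀ x t, HasDerivAt (w x) (g x t) t) (x : P) (t : ℝ) :
    HasDerivAt (fun t => iteratedFDeriv ℝ j (fun y => w y t) x)
      (iteratedFDeriv ℝ j (fun y => g y t) x) t := by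
  have h1 : ∀ y s, w y s = w y 0 + ∫ τ in (0 : ℝ)..s, g y τ := by
    intro y s
    rw [intervalIntegral.integral_eq_sub_of_hasDerivAt (fun τ _ => hd y τ)
      ((contDiff_time hg y).continuous.intervalIntegrable _ _)]
    abel
  have h2 : ∀ s, iteratedFDeriv ℝ j (fun y => w y s) x = iteratedFDeriv ℝ j (fun y => w y 0) x +
      ∫ τ in (0 : ℝ)..s, iteratedFDeriv ℝ j (fun y => g y τ) x := by
    intro s
    simp only [h1 _ s]
    have e := iteratedFDeriv_add_apply (𝕜 := ℝ) (i := j) (x := x) (f := fun y => w y 0)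
      (g := fun y => ∫ τ in (0 : ℝ)..s, g y τ) hw.contDiffAt ?_
    · rw [← iteratedFDeriv_intervalIntegral 0 s j le_rfl hg]
      exact e
    · exact (contDiff_parametric_intervalIntegral j 0 s g hg).contDiffAt
  rw [funext h2]
  have hc : Continuous (fun τ => iteratedFDeriv ℝ j (fun y => g y τ) x) :=
    (contDiff_iteratedFDeriv_fst (n := 0) j (by omega) hg).continuous.comp (Continuous.prodMk_right x)
  exact (intervalIntegral.integral_hasDerivAt_right (hc.intervalIntegrable _ _)
    (hc.stronglyMeasurableAtFilter _ _) hc.continuousAt).const_add _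

theorem norm_iteratedFDeriv_comp_le_of_decay {E F G : Type*} [NormedAddCommGroup E]
    [NormedSpace ℝ E] [NormedAddCommGroup F] [NormedSpace ℝ F] [NormedAddCommGroup G]
    [NormedSpace ℝ G] {g : F → G} {f : E → F} {j : ℕ} (hj : 1 ≤ j) (hg : ContDiff ℝ j g)
    (hf : ContDiff ℝ j f) {x : E} {C c s : ℝ} (hc : 1 ≤ c) (hs : 0 ≤ s)
    (h1 : ∀ i ≤ j, ‖iteratedFDeriv ℝ i g (f x)‖ ≤ C)
    (h2 : ∀ i, 1 ≤ i → i ≤ j → ‖iteratedFDeriv ℝ i f x‖ ≤ c * Real.exp (-s)) :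
    ‖iteratedFDeriv ℝ j (fun y => g (f y)) x‖ ≤ j.factorial * C * c ^ j * Real.exp (-s) := by
  have hj0 : (0 : ℝ) < j := by exact_mod_cast hj
  -- This form of the Faà di Bruno estimate wants geometric bounds `D ^ i`. With `D = c e^{-s/j}`
  -- one has `c e^{-s} ≤ D ^ i` for `1 ≤ i ≤ j`, while `D ^ j` retains the full factor `e^{-s}`.
  have key := norm_iteratedFDeriv_comp_le hg hf le_rfl x (C := C) (D := c * Real.exp (-s / j)) h1
    (fun i hi hij => (h2 i hi hij).trans ?_)
  · refine key.trans (le_of_eq ?_)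
    rw [mul_pow, ← Real.exp_nat_mul, mul_div_cancel₀ _ hj0.ne']
    ring
  · rw [mul_pow, ← Real.exp_nat_mul]
    refine mul_le_mul (le_self_pow₀ hc (by omega)) ?_ (Real.exp_pos _).le (by positivity)
    rw [Real.exp_le_exp, mul_div_assoc', le_div_iff₀ hj0]
    have : (i : ℝ) ≤ j := by exact_mod_cast hij
    nlinarith

variable {E : Type*} [NormedAddCommGroup E] [InnerProductSpace ℝ E]

/-- A Grönwall estimate with forcing `κ e^{-2γt}`, which is integrable against `e^{γt}` and so costs
only a constant in front of `e^{-γt}`. Squared norms avoid the point where the norm is not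
differentiable. -/
theorem norm_le_of_inner_deriv_le {z ζ : ℝ → E} {γ κ : ℝ} (hγ : 0 < γ) (hκ : 0 ≤ κ)
    (hz : ∀ t, HasDerivAt z (ζ t) t)
    (h : ∀ t, 0 ≤ t → inner ℝ (z t) (ζ t) ≤
      -γ * ‖z t‖ ^ 2 + κ * Real.exp (-γ * t) ^ 2 * ‖z t‖) {t : ℝ} (ht : 0 ≤ t) :
    ‖z t‖ ≤ 2 * (‖z 0‖ + κ / γ) * Real.exp (-γ * t) := by
  set c := κ / γ with hc
  have hκc : κ = c * γ := by rw [hc]; field_simp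
  have hc0 : 0 ≤ c := by positivity
  -- A Lyapunov function. The last factor contributes `-γ e^{-γt}` to the logarithmic derivative,
  -- which absorbs the forcing `2cγ‖z‖` by the arithmetic-geometric inequality; it lies between `1`
  -- and `e`, so it costs at most the factor `4` used below.
  let G : ℝ → ℝ := fun t => (Real.exp (γ * t) ^ 2 * ‖z t‖ ^ 2 + c ^ 2) * Real.exp (Real.exp (-γ * t))
  let G' : ℝ → ℝ := fun t =>
    (2 * Real.exp (γ * t) * (Real.exp (γ * t) * γ) * ‖z t‖ ^ 2 +
      Real.exp (γ * t) ^ 2 * (2 * inner ℝ (z t) (ζ t))) * Real.exp (Real.exp (-γ * t)) +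
    (Real.exp (γ * t) ^ 2 * ‖z t‖ ^ 2 + c ^ 2) *
      (Real.exp (Real.exp (-γ * t)) * (Real.exp (-γ * t) * -γ))
  have hG : ∀ t, HasDerivAt G (G' t) t := by
    intro t
    have h1 : HasDerivAt (fun t => Real.exp (γ * t)) (Real.exp (γ * t) * γ) t := by
      simpa using ((hasDerivAt_id t).const_mul γ).exp
    have h2 : HasDerivAt (fun t => Real.exp (-γ * t)) (Real.exp (-γ * t) * -γ) t := by
      simpa using ((hasDerivAt_id t).const_mul (-γ)).exp
    have h3 := (((h1.fun_pow 2).mul (hz t).norm_sq).add_const (c ^ 2)).mul h2.exp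
    convert! h3 using 1
    simp [G']
  have hle : ∀ t, 0 ≤ t → G' t ≤ 0 := by
    intro t ht
    have e1 : Real.exp (γ * t) * Real.exp (-γ * t) = 1 := by
      rw [← Real.exp_add]; simp
    set e := Real.exp (γ * t)
    set e' := Real.exp (-γ * t)
    have he : 0 < e := Real.exp_pos _
    have he' : 0 < e' := Real.exp_pos _
    have h1 := h t ht
    have h2 : e ^ 2 * (2 * inner ℝ (z t) (ζ t)) ≤
        -2 * γ * e ^ 2 * ‖z t‖ ^ 2 + 2 * c * γ * ‖z t‖ := by
      have := mul_le_mul_of_nonneg_left h1 (by positivity : 0 ≤ 2 * e ^ 2)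
      have e2 : 2 * e ^ 2 * (κ * e' ^ 2 * ‖z t‖) = 2 * c * γ * ‖z t‖ := by
        rw [hκc]
        linear_combination 2 * c * γ * ‖z t‖ * (e * e' + 1) * e1
      linarith [mul_add (2 * e ^ 2) (-γ * ‖z t‖ ^ 2) (κ * e' ^ 2 * ‖z t‖)]
    have h3 : 2 * c * γ * ‖z t‖ ≤ (e ^ 2 * ‖z t‖ ^ 2 + c ^ 2) * (e' * γ) := by
      have : 2 * c * γ * ‖z t‖ = (2 * (e * ‖z t‖) * c) * (e' * γ) := by
        linear_combination -2 * c * γ * ‖z t‖ * e1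
      rw [this]
      refine mul_le_mul_of_nonneg_right ?_ (by positivity)
      nlinarith [sq_nonneg (e * ‖z t‖ - c)]
    have : G' t = (2 * e * (e * γ) * ‖z t‖ ^ 2 + e ^ 2 * (2 * inner ℝ (z t) (ζ t)) -
        (e ^ 2 * ‖z t‖ ^ 2 + c ^ 2) * (e' * γ)) * Real.exp e' := by
      simp only [G']
      ring
    rw [this]
    refine mul_nonpos_of_nonpos_of_nonneg ?_ (Real.exp_pos _).le
    linarith
  have hanti : AntitoneOn G (Ici 0) := by
    refine antitoneOn_of_deriv_nonpos (convex_Ici 0)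
      (fun t _ => (hG t).continuousAt.continuousWithinAt)
      (fun t _ => (hG t).differentiableAt.differentiableWithinAt) fun t ht => ?_
    rw [(hG t).deriv]
    exact hle t (interior_subset ht)
  have h0 := hanti (mem_Ici.2 le_rfl) (mem_Ici.2 ht) ht
  have hG0 : G 0 = (‖z 0‖ ^ 2 + c ^ 2) * Real.exp 1 := by simp [G]
  have hexp : Real.exp 1 ≤ 4 := by linarith [Real.exp_one_lt_d9]
  have h1 : Real.exp (γ * t) ^ 2 * ‖z t‖ ^ 2 + c ^ 2 ≤ G t :=
    le_mul_of_one_le_right (by positivity) (Real.one_le_exp (Real.exp_pos _).le)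
  have h2 : (Real.exp (γ * t) * ‖z t‖) ^ 2 ≤ (2 * (‖z 0‖ + c)) ^ 2 := by
    have : (‖z 0‖ ^ 2 + c ^ 2) * Real.exp 1 ≤ (‖z 0‖ ^ 2 + c ^ 2) * 4 :=
      mul_le_mul_of_nonneg_left hexp (by positivity)
    nlinarith [mul_nonneg (norm_nonneg (z 0)) hc0, sq_nonneg c]
  have h3 := abs_le_of_sq_le_sq h2 (by positivity)
  have h4 := (abs_le.1 h3).2
  have e1 : Real.exp (-γ * t) * Real.exp (γ * t) = 1 := by
    rw [← Real.exp_add]; simp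
  calc ‖z t‖ = Real.exp (γ * t) * ‖z t‖ * Real.exp (-γ * t) := by
        linear_combination -‖z t‖ * e1
    _ ≤ _ := mul_le_mul_of_nonneg_right h4 (Real.exp_pos _).le

/-- A globally defined vector field which is dissipative with rate `γ` on the ball of radius `r`,
and whose derivatives up to order `n` are bounded by `M` there. -/
structure DissipativeField (V : E → E) (γ r M : ℝ) (n : ℕ) : Prop where
  contDiff : ContDiff ℝ n V
  lipschitz : ∃ K : ℝ≥0, LipschitzWith K V
  bounded : ∃ L : ℝ≥0, ∀ x, ‖V x‖ ≤ L
  inward : ∀ x, inner ℝ x (V x) ≤ 0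
  dissipative : ∀ x ∈ ball (0 : E) r, ∀ v, inner ℝ v (fderiv ℝ V x v) ≤ -γ * ‖v‖ ^ 2
  one_le : 1 ≤ M
  bound : ∀ x ∈ ball (0 : E) r, ∀ j ≤ n, ‖iteratedFDeriv ℝ j V x‖ ≤ M

variable {V : E → E} {X : E → ℝ → E} {γ r M : ℝ} {n : ℕ}

theorem DissipativeField.mem_ball (hV : DissipativeField V γ r M n) (hX : IsFlow V X) {x : E}
    (hx : x ∈ ball (0 : E) r) {t : ℝ} (ht : 0 ≤ t) : X x t ∈ ball (0 : E) r := by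
  have hd : ∀ t, HasDerivAt (fun t => ‖X x t‖ ^ 2) (2 * inner ℝ (X x t) (V (X x t))) t :=
    fun t => (hX.hasDerivAt x t).norm_sq
  have ha : Antitone (fun t => ‖X x t‖ ^ 2) := by
    refine antitone_of_deriv_nonpos (fun t => (hd t).differentiableAt) fun t => ?_
    rw [(hd t).deriv]
    linarith [hV.inward (X x t)]
  have h1 := ha ht
  simp only [hX.zero] at h1
  have h2 := abs_le_of_sq_le_sq h1 (norm_nonneg _)
  rw [mem_ball_zero_iff] at hx ⊢
  linarith [(abs_le.1 h2).2]

theorem norm_iteratedFDeriv_id_le {j : ℕ} (hj : 1 ≤ j) (x : E) :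
    ‖iteratedFDeriv ℝ j (fun y : E => y) x‖ ≤ 1 := by
  obtain ⟨i, rfl⟩ : ∃ i, j = i + 1 := ⟨j - 1, by omega⟩
  rw [← norm_iteratedFDeriv_fderiv]
  have : fderiv ℝ (fun y : E => y) = fun _ => ContinuousLinearMap.id ℝ E := by
    funext y; exact fderiv_fun_id
  rw [this]
  rcases Nat.eq_zero_or_pos i with rfl | hi
  · simpa using ContinuousLinearMap.norm_id_le
  · rw [iteratedFDeriv_const_of_ne hi.ne']
    simp

variable [FiniteDimensional ℝ E]

theorem DissipativeField.contDiff_flow (hV : DissipativeField V γ r M n) (hn : n ≠ 0)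
    (hX : IsFlow V X) : ContDiff ℝ n (fun p : E × ℝ => X p.1 p.2) := by
  obtain ⟨K, hK⟩ := hV.lipschitz
  obtain ⟨L, hL⟩ := hV.bounded
  exact hX.contDiff hK hL hn hV.contDiff

/-- The derivative of order `i + 1` of `X` solves a linear equation whose homogeneous part is the
dissipative `fderiv ℝ V (X x s)`. The remainder only involves derivatives of `X` of order between
`1` and `i`, at least two at a time, hence is `O(e^{-2γs})`. -/
theorem DissipativeField.norm_iteratedFDeriv_flow_le (hγ : 0 < γ) (hV : DissipativeField V γ r M n)
    (hX : IsFlow V X) {c : ℝ} (hc : 1 ≤ c) {i : ℕ} (hi : i + 1 ≤ n)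
    (hind : ∀ x ∈ ball (0 : E) r, ∀ t : ℝ, 0 ≤ t → ∀ j, 1 ≤ j → j ≤ i →
      ‖iteratedFDeriv ℝ j (fun y => X y t) x‖ ≤ c * Real.exp (-γ * t))
    {x : E} (hx : x ∈ ball (0 : E) r) {t : ℝ} (ht : 0 ≤ t) :
    ‖iteratedFDeriv ℝ (i + 1) (fun y => X y t) x‖ ≤
      2 * (1 + 2 ^ i * (i.factorial * M * c ^ (i + 1)) / γ) * Real.exp (-γ * t) := by
  have hXc := hV.contDiff_flow (by omega) hX
  have hM0 : 0 ≤ M := zero_le_one.trans hV.one_le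
  have hXc' : ContDiff ℝ (i + 1 : ℕ) (fun p : E × ℝ => X p.1 p.2) :=
    hXc.of_le (by exact_mod_cast hi)
  have hVc : ContDiff ℝ (i + 1 : ℕ) V := hV.contDiff.of_le (by exact_mod_cast hi)
  have hVX : ContDiff ℝ (i + 1 : ℕ) (fun p : E × ℝ => V (X p.1 p.2)) := hVc.comp hXc'
  have hder := hasDerivAt_iteratedFDeriv_slice (contDiff_slice hXc' 0) hVX hX.hasDerivAt x
  set κ := 2 ^ i * (i.factorial * M * c ^ (i + 1)) with hκ
  have hκ0 : 0 ≤ κ := by positivity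
  have hrem : ∀ s, 0 ≤ s → ‖iteratedFDeriv ℝ (i + 1) (fun y => V (X y s)) x -
      (fderiv ℝ V (X x s)).compContinuousMultilinearMap
        (iteratedFDeriv ℝ (i + 1) (fun y => X y s) x)‖ ≤ κ * Real.exp (-γ * s) ^ 2 := by
    intro s hs
    -- Freezing the linearization at the base point identifies the remainder as a derivative of `V
    -- (X y s) - B (X y s)`. Its gradient is `(fderiv ℝ V (X y s) - B)` composed with the gradient
    -- of `X`, so in Leibniz's rule the term with no derivative on the first factor vanishes at `y =
    -- x`, and with it the top order.
    set B := fderiv ℝ V (X x s) with hB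
    have hXs : ContDiff ℝ (i + 1 : ℕ) (fun y => X y s) := contDiff_slice hXc' s
    have hVXs : ContDiff ℝ (i + 1 : ℕ) (fun y => V (X y s)) := contDiff_slice (w := fun y s => V (X y s)) hVX s
    have h1 : iteratedFDeriv ℝ (i + 1) (fun y => V (X y s)) x - B.compContinuousMultilinearMap
        (iteratedFDeriv ℝ (i + 1) (fun y => X y s) x) =
        iteratedFDeriv ℝ (i + 1) (fun y => V (X y s) - B (X y s)) x := by
      rw [← B.iteratedFDeriv_comp_left hXs.contDiffAt le_rfl]
      exact (iteratedFDeriv_sub_apply hVXs.contDiffAt (B.contDiff.comp hXs).contDiffAt).symm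
    have hX1 : ContDiff ℝ i (fderiv ℝ (fun y => X y s)) := hXs.fderiv_right (by norm_cast)
    have hV1 : ContDiff ℝ i (fderiv ℝ V) := hVc.fderiv_right (by norm_cast)
    have hV1X : ContDiff ℝ i (fun y => fderiv ℝ V (X y s)) :=
      hV1.comp (hXs.of_le (by norm_cast; omega))
    have h2 : fderiv ℝ (fun y => V (X y s) - B (X y s)) = fun y =>
        ContinuousLinearMap.compL ℝ E E E (fderiv ℝ V (X y s) - B) (fderiv ℝ (fun y => X y s) y) := by
      funext y
      have e1 : HasFDerivAt (fun y => X y s) (fderiv ℝ (fun y => X y s) y) y :=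
        (hXs.differentiable (by simp)).differentiableAt.hasFDerivAt
      have e2 : HasFDerivAt V (fderiv ℝ V (X y s)) (X y s) :=
        (hVc.differentiable (by simp)).differentiableAt.hasFDerivAt
      have e3 : HasFDerivAt (fun y => V (X y s) - B (X y s)) _ y :=
        (e2.comp y e1).sub (B.hasFDerivAt.comp y e1)
      rw [e3.fderiv]
      ext v
      simp
    rw [h1, ← norm_iteratedFDeriv_fderiv, h2]
    refine ((ContinuousLinearMap.compL ℝ E E E).norm_iteratedFDeriv_le_of_bilinear_of_le_one
      (hV1X.sub contDiff_const) hX1 x le_rfl (ContinuousLinearMap.norm_compL_le ℝ E E E)).trans ?_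
    have hterm : ∀ l ∈ Finset.range (i + 1), (i.choose l : ℝ) *
        ‖iteratedFDeriv ℝ l (fun y => fderiv ℝ V (X y s) - B) x‖ *
        ‖iteratedFDeriv ℝ (i - l) (fderiv ℝ (fun y => X y s)) x‖ ≤
        (i.choose l : ℝ) * ((i.factorial * M * c ^ (i + 1)) * Real.exp (-γ * s) ^ 2) := by
      intro l hl
      have hl' : l ≤ i := by simpa [Nat.lt_succ_iff] using hl
      rw [mul_assoc]
      refine mul_le_mul_of_nonneg_left ?_ (Nat.cast_nonneg _)
      rcases Nat.eq_zero_or_pos l with rfl | hl0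
      · have : ‖iteratedFDeriv ℝ 0 (fun y => fderiv ℝ V (X y s) - B) x‖ = 0 := by
          rw [norm_iteratedFDeriv_zero, hB, sub_self, norm_zero]
        rw [this, zero_mul]
        positivity
      · have e1 : iteratedFDeriv ℝ l (fun y => fderiv ℝ V (X y s) - B) x =
            iteratedFDeriv ℝ l (fun y => fderiv ℝ V (X y s)) x := by
          have := iteratedFDeriv_sub_apply (𝕜 := ℝ) (i := l) (x := x)
            (f := fun y => fderiv ℝ V (X y s)) (g := fun _ => B)
            (hV1X.of_le (by exact_mod_cast hl')).contDiffAt contDiff_const.contDiffAt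
          rw [iteratedFDeriv_const_of_ne hl0.ne', Pi.zero_apply, sub_zero] at this
          exact this
        have e2 : ‖iteratedFDeriv ℝ l (fun y => fderiv ℝ V (X y s)) x‖ ≤
            l.factorial * M * c ^ l * Real.exp (-(γ * s)) := by
          refine norm_iteratedFDeriv_comp_le_of_decay hl0 (hV1.of_le (by exact_mod_cast hl'))
            (hXs.of_le (by norm_cast; omega)) hc (by positivity) (fun q hq => ?_)
            (fun q hq1 hq2 => ?_)
          · rw [norm_iteratedFDeriv_fderiv]
            exact hV.bound _ (hV.mem_ball hX hx hs) _ (by omega)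
          · simpa using hind x hx s hs q hq1 (hq2.trans hl')
        have e3 : ‖iteratedFDeriv ℝ (i - l) (fderiv ℝ (fun y => X y s)) x‖ ≤
            c * Real.exp (-γ * s) := by
          rw [norm_iteratedFDeriv_fderiv]
          exact hind x hx s hs _ (by omega) (by omega)
        rw [e1]
        refine (mul_le_mul e2 e3 (norm_nonneg _) (by positivity)).trans ?_
        have e4 : (l.factorial : ℝ) ≤ i.factorial := by exact_mod_cast Nat.factorial_le hl'
        have e5 : c ^ l ≤ c ^ i := pow_le_pow_right₀ hc hl'
        rw [← neg_mul]
        calc _ = (l.factorial * M * c ^ l) * (c * Real.exp (-γ * s) ^ 2) := by ring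
          _ ≤ (i.factorial * M * c ^ i) * (c * Real.exp (-γ * s) ^ 2) := by gcongr
          _ = _ := by ring
    refine (Finset.sum_le_sum hterm).trans (le_of_eq ?_)
    rw [← Finset.sum_mul, hκ]
    have : ∑ l ∈ Finset.range (i + 1), (i.choose l : ℝ) = 2 ^ i := by
      exact_mod_cast Nat.sum_range_choose i
    rw [this]
    ring
  -- The Grönwall estimate needs an inner product, so it is applied to the `E`-valued function
  -- obtained by evaluating on fixed vectors.
  refine ContinuousMultilinearMap.opNorm_le_bound (by positivity) fun m => ?_
  have hz : ∀ s, HasDerivAt (fun s => iteratedFDeriv ℝ (i + 1) (fun y => X y s) x m)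
      (iteratedFDeriv ℝ (i + 1) (fun y => V (X y s)) x m) s := by
    intro s
    have := (ContinuousMultilinearMap.apply ℝ (fun _ : Fin (i + 1) => E) E m).hasFDerivAt.comp_hasDerivAt s (hder s)
    exact this
  have hmain := norm_le_of_inner_deriv_le (κ := κ * ∏ q, ‖m q‖) hγ (by positivity) hz ?_ ht
  · refine hmain.trans ?_
    have h0 : ‖iteratedFDeriv ℝ (i + 1) (fun y => X y 0) x m‖ ≤ ∏ q, ‖m q‖ := by
      simp only [hX.zero]
      refine (ContinuousMultilinearMap.le_opNorm _ m).trans ?_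
      exact mul_le_of_le_one_left (by positivity) (norm_iteratedFDeriv_id_le (by omega) x)
    calc _ ≤ 2 * ((∏ q, ‖m q‖) + (κ * ∏ q, ‖m q‖) / γ) * Real.exp (-γ * t) := by gcongr
      _ = _ := by ring
  · intro s hs
    set z := iteratedFDeriv ℝ (i + 1) (fun y => X y s) x m with hzdef
    have h1 := (hrem s hs)
    have h2 : ‖iteratedFDeriv ℝ (i + 1) (fun y => V (X y s)) x m - fderiv ℝ V (X x s) z‖ ≤
        κ * Real.exp (-γ * s) ^ 2 * ∏ q, ‖m q‖ :=
      (ContinuousMultilinearMap.le_opNorm _ m).trans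
        (mul_le_mul_of_nonneg_right h1 (by positivity))
    have h3 := hV.dissipative _ (hV.mem_ball hX hx hs) z
    have h4 := (real_inner_le_norm z (iteratedFDeriv ℝ (i + 1) (fun y => V (X y s)) x m -
      fderiv ℝ V (X x s) z)).trans (mul_le_mul_of_nonneg_left h2 (norm_nonneg z))
    rw [inner_sub_right] at h4
    nlinarith

/-- Induction on the order. `C` and `p` are chosen before the field, the radius and `M`, which is
what makes the final bound a polynomial in the norms of the data. -/
theorem exists_flow_decay (E : Type*) [NormedAddCommGroup E] [InnerProductSpace ℝ E]
    [FiniteDimensional ℝ E] {γ : ℝ} (hγ : 0 < γ) (n i : ℕ) (hi : i ≤ n) : ∃ C : ℝ, ∃ p : ℕ, 1 ≤ C ∧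
    ∀ (V : E → E) (X : E → ℝ → E) (r M : ℝ), DissipativeField V γ r M n → IsFlow V X →
    ∀ x ∈ ball (0 : E) r, ∀ t : ℝ, 0 ≤ t → ∀ j, 1 ≤ j → j ≤ i →
      ‖iteratedFDeriv ℝ j (fun y => X y t) x‖ ≤ C * M ^ p * Real.exp (-γ * t) := by
  induction i with
  | zero => exact ⟨1, 0, le_rfl, fun V X r M _ _ x _ t _ j h1 h2 => by omega⟩
  | succ i ih =>
    obtain ⟨C, p, hC, h⟩ := ih (by omega)
    refine ⟨C + 2 * (1 + 2 ^ i * (i.factorial * C ^ (i + 1)) / γ), p * (i + 1) + 1, ?_, ?_⟩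
    · have : 0 ≤ 2 * (1 + 2 ^ i * (i.factorial * C ^ (i + 1)) / γ) := by positivity
      linarith
    intro V X r M hV hX x hx t ht j h1 h2
    have hM := hV.one_le
    have hM' : ∀ q, 1 ≤ M ^ q := fun q => one_le_pow₀ hM
    rcases Nat.lt_or_ge i j with hij | hij
    · obtain rfl : j = i + 1 := by omega
      have hc : 1 ≤ C * M ^ p := one_le_mul_of_one_le_of_one_le hC (hM' p)
      refine (hV.norm_iteratedFDeriv_flow_le hγ hX hc hi (h V X r M hV hX) hx ht).trans ?_
      refine mul_le_mul_of_nonneg_right ?_ (Real.exp_pos _).le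
      have e : 2 * (1 + 2 ^ i * (i.factorial * M * (C * M ^ p) ^ (i + 1)) / γ) =
        2 + 2 * (2 ^ i * (i.factorial * C ^ (i + 1)) / γ) * M ^ (p * (i + 1) + 1) := by
        rw [mul_pow, ← pow_mul, pow_succ]; ring
      rw [e]
      have h5 := hM' (p * (i + 1) + 1)
      nlinarith
    · refine (h V X r M hV hX x hx t ht j h1 hij).trans ?_
      refine mul_le_mul_of_nonneg_right ?_ (Real.exp_pos _).le
      refine mul_le_mul ?_ (pow_le_pow_right₀ hM (by nlinarith)) (by positivity) (by positivity)
      have : 0 ≤ 2 * (1 + 2 ^ i * (i.factorial * C ^ (i + 1)) / γ) := by positivity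
      linarith

end FlowDecay

end SGDExpansion

namespace SGDExpansion

open Filter Topology
open scoped NNReal

set_option maxSynthPendingDepth 4

/-! ### Linearity of the operators -/

section Linearity

variable {E : Type*} [NormedAddCommGroup E] [NormedSpace ℝ E]

/-- The operator `v ↦ W · ∇v + A : ∇²v`. -/
noncomputable def secondOrder (W : E → E) (A : E → (E →L[ℝ] E →L[ℝ] ℝ) →L[ℝ] ℝ) (v : E → ℝ)
    (x : E) : ℝ := drift W v x + diffusion A v x

/-- The operator `v ↦ V · ∇v + η (W · ∇v + A : ∇²v)`. -/
noncomputable def perturbed (V W : E → E) (A : E → (E →L[ℝ] E →L[ℝ] ℝ) →L[ℝ] ℝ) (η : ℝ) (v : E → ℝ)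
    (x : E) : ℝ := drift V v x + η * secondOrder W A v x

variable {v₁ v₂ : E → ℝ} (V W : E → E) (A : E → (E →L[ℝ] E →L[ℝ] ℝ) →L[ℝ] ℝ) (c η : ℝ) (x : E)

theorem fderiv_add_const_mul (h₁ : Differentiable ℝ v₁) (h₂ : Differentiable ℝ v₂) :
    fderiv ℝ (fun y => v₁ y + c * v₂ y) x = fderiv ℝ v₁ x + c • fderiv ℝ v₂ x :=
  (h₁.differentiableAt.hasFDerivAt.add (h₂.differentiableAt.hasFDerivAt.const_mul c)).fderiv

theorem drift_add_const_mul (h₁ : Differentiable ℝ v₁) (h₂ : Differentiable ℝ v₂) :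
    drift V (fun y => v₁ y + c * v₂ y) x = drift V v₁ x + c * drift V v₂ x := by
  simp [drift, fderiv_add_const_mul c x h₁ h₂]

theorem diffusion_add_const_mul (h₁ : ContDiff ℝ 2 v₁) (h₂ : ContDiff ℝ 2 v₂) :
    diffusion A (fun y => v₁ y + c * v₂ y) x = diffusion A v₁ x + c * diffusion A v₂ x := by
  have e : fderiv ℝ (fun y => v₁ y + c * v₂ y) = fun y => fderiv ℝ v₁ y + c • fderiv ℝ v₂ y :=
    funext fun y => fderiv_add_const_mul c y (h₁.differentiable (by simp))
      (h₂.differentiable (by simp))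
  have d₁ : Differentiable ℝ (fderiv ℝ v₁) :=
    (h₁.fderiv_right (m := 1) (by norm_num)).differentiable (by simp)
  have d₂ : Differentiable ℝ (fderiv ℝ v₂) :=
    (h₂.fderiv_right (m := 1) (by norm_num)).differentiable (by simp)
  have e2 : fderiv ℝ (fun y => fderiv ℝ v₁ y + c • fderiv ℝ v₂ y) x =
      fderiv ℝ (fderiv ℝ v₁) x + c • fderiv ℝ (fderiv ℝ v₂) x :=
    (d₁.differentiableAt.hasFDerivAt.add (d₂.differentiableAt.hasFDerivAt.const_smul c)).fderiv
  simp [diffusion, e, e2]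

theorem secondOrder_add_const_mul (h₁ : ContDiff ℝ 2 v₁) (h₂ : ContDiff ℝ 2 v₂) :
    secondOrder W A (fun y => v₁ y + c * v₂ y) x =
      secondOrder W A v₁ x + c * secondOrder W A v₂ x := by
  simp only [secondOrder, diffusion_add_const_mul A c x h₁ h₂,
    drift_add_const_mul W c x (h₁.differentiable (by simp)) (h₂.differentiable (by simp))]
  ring

theorem perturbed_add_const_mul (h₁ : ContDiff ℝ 2 v₁) (h₂ : ContDiff ℝ 2 v₂) :
    perturbed V W A η (fun y => v₁ y + c * v₂ y) x =
      perturbed V W A η v₁ x + c * perturbed V W A η v₂ x := by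
  simp only [perturbed, secondOrder_add_const_mul W A c x h₁ h₂,
    drift_add_const_mul V c x (h₁.differentiable (by simp)) (h₂.differentiable (by simp))]
  ring

end Linearity

/-! ### The method of characteristics and Duhamel's formula -/

section TransportEquation

variable {E : Type} [NormedAddCommGroup E] [NormedSpace ℝ E]
  {V : E → E} {X : E → ℝ → E} {K : ℝ≥0}

/-- The characteristics of `∂ₜw = V·∇w + g` are the backward trajectories `t ↦ X y (-t)`. The chain
rule along the one through `(x,t)`, which starts at `y = X x t`, gives the equation. -/
theorem IsFlow.hasDerivAt_of_along (hX : IsFlow V X) (hK : LipschitzWith K V) {w g : E → ℝ → ℝ}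
    (hw : ContDiff ℝ 1 (fun p : E × ℝ => w p.1 p.2))
    (h : ∀ y t, HasDerivAt (fun t => w (X y (-t)) t) (g (X y (-t)) t) t) (x : E) (t : ℝ) :
    HasDerivAt (w x) (drift V (fun y => w y t) x + g x t) t := by
  have hd := hw.differentiable one_ne_zero
  set y := X x t with hy
  have hyx : X y (-t) = x := by rw [hy, ← hX.add hK]; simp [hX.zero]
  have h1 := h y t
  have h2 : HasDerivAt (fun s => X y (-s)) (-(V x)) t := by
    have := (hX.hasDerivAt y (-t)).scomp t (hasDerivAt_neg t)
    rw [hyx] at this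
    simpa [Function.comp_def] using this
  have h3 := HasFDerivAt.comp_hasDerivAt t (f := fun s => (X y (-s), s))
    (hd (X y (-t), t)).hasFDerivAt (h2.prodMk (hasDerivAt_id t))
  have h4 := h1.unique h3
  rw [hyx] at h4
  have h5 : (-V x, (1 : ℝ)) = (0, 1) - (V x, 0) := by simp
  rw [h5, map_sub, ← deriv_time_eq hd] at h4
  have h6 : drift V (fun y => w y t) x = fderiv ℝ (fun p : E × ℝ => w p.1 p.2) (x, t) (V x, 0) := by
    simp [drift, fderiv_slice_eq hd]
  have h7 : drift V (fun y => w y t) x + g x t = deriv (w x) t := by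
    rw [h4, h6]; ring
  rw [h7]
  exact (((contDiff_time hw x).differentiable one_ne_zero) t).hasDerivAt

variable [FiniteDimensional ℝ E]

/-- The substitution `s ↦ t s` makes the limits of integration constant, and `(x,t)` becomes a
parameter. `E` lives in `Type` because the smoothness of parametric integrals was proved with
parameter and value spaces in one universe, here that of `ℝ`. -/
theorem contDiff_duhamel {m : ℕ} {g : E → ℝ → ℝ}
    (hX : ContDiff ℝ m (fun p : E × ℝ => X p.1 p.2))
    (hg : ContDiff ℝ m (fun p : E × ℝ => g p.1 p.2)) :
    ContDiff ℝ m (fun p : E × ℝ => ∫ s in (0 : ℝ)..p.2, g (X p.1 (p.2 - s)) s) := by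
  have h : ∀ p : E × ℝ, ∫ s in (0 : ℝ)..p.2, g (X p.1 (p.2 - s)) s =
      p.2 * ∫ s in (0 : ℝ)..1, g (X p.1 (p.2 - p.2 * s)) (p.2 * s) := by
    intro p
    have := intervalIntegral.smul_integral_comp_mul_left (a := 0) (b := 1)
      (fun s => g (X p.1 (p.2 - s)) s) p.2
    simpa using this.symm
  simp only [h]
  refine contDiff_snd.mul (contDiff_parametric_intervalIntegral m 0 1
    (fun (p : E × ℝ) s => g (X p.1 (p.2 - p.2 * s)) (p.2 * s)) ?_)
  have h1 : ContDiff ℝ m (fun q : (E × ℝ) × ℝ => X q.1.1 (q.1.2 - q.1.2 * q.2)) :=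
    hX.comp (g := fun p : E × ℝ => X p.1 p.2) (f := fun q : (E × ℝ) × ℝ => (q.1.1, q.1.2 - q.1.2 * q.2))
      (by fun_prop)
  exact hg.comp (g := fun p : E × ℝ => g p.1 p.2)
    (f := fun q : (E × ℝ) × ℝ => (X q.1.1 (q.1.2 - q.1.2 * q.2), q.1.2 * q.2))
    (h1.prodMk (by fun_prop))

/-- Along a characteristic the integrand no longer depends on `t`, since `X (X y (-t)) (t - s) = X y
(-s)`. Only the upper limit is left to differentiate. -/
theorem IsFlow.hasDerivAt_duhamel (hX : IsFlow V X) (hK : LipschitzWith K V)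
    (hXc : ContDiff ℝ 1 (fun p : E × ℝ => X p.1 p.2)) {g : E → ℝ → ℝ}
    (hg : ContDiff ℝ 1 (fun p : E × ℝ => g p.1 p.2)) (x : E) (t : ℝ) :
    HasDerivAt (fun t => ∫ s in (0 : ℝ)..t, g (X x (t - s)) s)
      (drift V (fun y => ∫ s in (0 : ℝ)..t, g (X y (t - s)) s) x + g x t) t := by
  refine hX.hasDerivAt_of_along hK (w := fun x t => ∫ s in (0 : ℝ)..t, g (X x (t - s)) s)
    (by exact_mod_cast contDiff_duhamel (m := 1) hXc hg) (fun y t => ?_) x t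
  have e : ∀ t s, X (X y (-t)) (t - s) = X y (-s) := fun t s => by
    rw [← hX.add hK]; congr 1; ring
  simp only [e]
  have hc : Continuous (fun s => g (X y (-s)) s) :=
    hg.continuous.comp (((contDiff_time hXc y).continuous.comp continuous_neg).prodMk continuous_id)
  exact intervalIntegral.integral_hasDerivAt_right (hc.intervalIntegrable _ _)
    (hc.stronglyMeasurableAtFilter _ _) hc.continuousAt

end TransportEquation

/-! ### The coefficients of the expansion and the equations they satisfy -/

section Expansion

variable {E : Type} [NormedAddCommGroup E] [InnerProductSpace ℝ E]

/-- Globally defined coefficients `V, W, A` and initial datum `φ`, with derivatives bounded by `M` on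
the ball of radius `r`. -/
structure Coefficients (V W : E → E) (A : E → (E →L[ℝ] E →L[ℝ] ℝ) →L[ℝ] ℝ) (φ : E → ℝ)
    (γ r M : ℝ) (n : ℕ) : Prop where
  field : DissipativeField V γ r M n
  contDiff_W : ContDiff ℝ (n - 1 : ℕ) W
  contDiff_A : ContDiff ℝ (n - 2 : ℕ) A
  contDiff_φ : ContDiff ℝ n φ
  bound_W : ∀ x ∈ ball (0 : E) r, ∀ j ≤ n - 1, ‖iteratedFDeriv ℝ j W x‖ ≤ M
  bound_A : ∀ x ∈ ball (0 : E) r, ∀ j ≤ n - 2, ‖iteratedFDeriv ℝ j A x‖ ≤ M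
  bound_φ : ∀ x ∈ ball (0 : E) r, ∀ j ≤ n, ‖iteratedFDeriv ℝ j φ x‖ ≤ M

/-- The coefficients of the formal expansion, given by Duhamel's formula along the flow `X`. -/
noncomputable def coeff (X : E → ℝ → E) (W : E → E) (A : E → (E →L[ℝ] E →L[ℝ] ℝ) →L[ℝ] ℝ)
    (φ : E → ℝ) : ℕ → E → ℝ → ℝ
  | 0 => fun x t => φ (X x t)
  | l + 1 => fun x t => ∫ s in (0 : ℝ)..t,
      secondOrder W A (fun y => coeff X W A φ l y s) (X x (t - s))

variable {V W : E → E} {A : E → (E →L[ℝ] E →L[ℝ] ℝ) →L[ℝ] ℝ} {φ : E → ℝ} {γ r M : ℝ} {n : ℕ}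
  {X : E → ℝ → E}

theorem Coefficients.contDiff_secondOrder (h : Coefficients V W A φ γ r M n) {m : ℕ}
    (hm : m + 2 ≤ n) {w : E → ℝ → ℝ}
    (hw : ContDiff ℝ (m + 2 : ℕ) (fun p : E × ℝ => w p.1 p.2)) :
    ContDiff ℝ m (fun p : E × ℝ => secondOrder W A (fun y => w y p.2) p.1) :=
  (contDiff_drift (h.contDiff_W.of_le (by norm_cast; omega))
    (hw.of_le (by norm_cast; omega))).add
    (contDiff_diffusion (h.contDiff_A.of_le (by norm_cast; omega)) hw)

theorem Coefficients.decay_secondOrder (h : Coefficients V W A φ γ r M n) {m : ℕ}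
    (hm : m + 2 ≤ n) {w : E → ℝ → ℝ} {a c : ℝ} (hc : 0 ≤ c) (hw : Decay r a c 1 (m + 2) w) :
    Decay r a (2 ^ (m + 1) * M * c) 0 m (fun x t => secondOrder W A (fun y => w y t) x) := by
  have hM : 0 ≤ M := zero_le_one.trans h.field.one_le
  have h1 := (hw.mono le_rfl (Nat.le_succ (m + 1)) le_rfl).drift (V := W)
    (h.contDiff_W.of_le (by norm_cast; omega))
    (fun x hx j hj => h.bound_W x hx j (by omega)) hM hc
  have h2 := hw.diffusion (A := A) (h.contDiff_A.of_le (by norm_cast; omega))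
    (fun x hx j hj => h.bound_A x hx j (by omega)) hM hc
  refine (h1.add h2).mono (le_of_eq ?_) le_rfl le_rfl
  ring

theorem Coefficients.decay_perturbed (h : Coefficients V W A φ γ r M n) {m : ℕ}
    (hm : m + 2 ≤ n) {w : E → ℝ → ℝ} {a c η : ℝ} (hc : 0 ≤ c) (hη : 0 ≤ η)
    (hw : Decay r a c 1 (m + 2) w) :
    Decay r a ((1 + η) * (2 ^ (m + 1) * M * c)) 0 m
      (fun x t => perturbed V W A η (fun y => w y t) x) := by
  have hM : 0 ≤ M := zero_le_one.trans h.field.one_le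
  have h1 := (hw.mono le_rfl (Nat.le_succ (m + 1)) le_rfl).drift (V := V)
    (h.field.contDiff.of_le (by norm_cast; omega))
    (fun x hx j hj => h.field.bound x hx j (by omega)) hM hc
  have h2 := (h.decay_secondOrder hm hc hw).const_mul η
  refine (h1.add h2).mono ?_ le_rfl le_rfl
  rw [abs_of_nonneg hη, add_mul, pow_succ]
  have : 0 ≤ 2 ^ m * M * c := by positivity
  nlinarith

theorem Coefficients.iteratedDeriv_secondOrder (h : Coefficients V W A φ γ r M n) {i : ℕ}
    (hi : i + 2 ≤ n) {w : E → ℝ → ℝ}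
    (hw : ContDiff ℝ (i + 2 : ℕ) (fun p : E × ℝ => w p.1 p.2)) (x : E) (t : ℝ) :
    iteratedDeriv i (fun t => secondOrder W A (fun y => w y t) x) t =
      secondOrder W A (fun y => iteratedDeriv i (w y) t) x := by
  have hw1 : ContDiff ℝ (i + 1 : ℕ) (fun p : E × ℝ => w p.1 p.2) :=
    hw.of_le (by norm_cast; omega)
  have h1 : ContDiff ℝ i (fun t => drift W (fun y => w y t) x) :=
    contDiff_time (w := fun x t => drift W (fun y => w y t) x)
      (contDiff_drift (h.contDiff_W.of_le (by norm_cast; omega)) hw1) x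
  have h2 : ContDiff ℝ i (fun t => diffusion A (fun y => w y t) x) :=
    contDiff_time (w := fun x t => diffusion A (fun y => w y t) x)
      (contDiff_diffusion (h.contDiff_A.of_le (by norm_cast; omega)) hw) x
  have e : iteratedDeriv i (fun t => drift W (fun y => w y t) x + diffusion A (fun y => w y t) x) t
      = _ := iteratedDeriv_fun_add h1.contDiffAt h2.contDiffAt
  simp only [secondOrder]
  rw [e, iteratedDeriv_drift W x i hw1, iteratedDeriv_diffusion A x i hw]

theorem Coefficients.iteratedDeriv_perturbed (h : Coefficients V W A φ γ r M n) {i : ℕ}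
    (hi : i + 2 ≤ n) {w : E → ℝ → ℝ}
    (hw : ContDiff ℝ (i + 2 : ℕ) (fun p : E × ℝ => w p.1 p.2)) (η : ℝ) (x : E) (t : ℝ) :
    iteratedDeriv i (fun t => perturbed V W A η (fun y => w y t) x) t =
      perturbed V W A η (fun y => iteratedDeriv i (w y) t) x := by
  have hw1 : ContDiff ℝ (i + 1 : ℕ) (fun p : E × ℝ => w p.1 p.2) :=
    hw.of_le (by norm_cast; omega)
  have h1 : ContDiff ℝ i (fun t => drift V (fun y => w y t) x) :=
    contDiff_time (w := fun x t => drift V (fun y => w y t) x)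
      (contDiff_drift (h.field.contDiff.of_le (by norm_cast; omega)) hw1) x
  have h2 : ContDiff ℝ i (fun t => secondOrder W A (fun y => w y t) x) :=
    contDiff_time (w := fun x t => secondOrder W A (fun y => w y t) x)
      (h.contDiff_secondOrder hi hw) x
  have e : iteratedDeriv i (fun t => drift V (fun y => w y t) x +
      η * secondOrder W A (fun y => w y t) x) t = _ :=
    iteratedDeriv_fun_add h1.contDiffAt (contDiff_const.mul h2).contDiffAt
  simp only [perturbed]
  rw [e, iteratedDeriv_drift V x i hw1, iteratedDeriv_const_mul_field,
    h.iteratedDeriv_secondOrder hi hw]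

variable [FiniteDimensional ℝ E]

theorem Coefficients.contDiff_coeff (h : Coefficients V W A φ γ r M n) (hn : n ≠ 0)
    (hX : IsFlow V X) (l : ℕ) : ∀ {m : ℕ}, m + 2 * l ≤ n →
    ContDiff ℝ m (fun p : E × ℝ => coeff X W A φ l p.1 p.2) := by
  have hXc := h.field.contDiff_flow hn hX
  induction l with
  | zero =>
    intro m hm
    exact (h.contDiff_φ.of_le (by norm_cast)).comp (hXc.of_le (by norm_cast))
  | succ l ih =>
    intro m hm
    exact contDiff_duhamel (m := m) (g := fun x t => secondOrder W A (fun y => coeff X W A φ l y t) x)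
      (hXc.of_le (Nat.cast_le.2 (by omega)))
      (h.contDiff_secondOrder (by omega) (ih (m := m + 2) (by omega)))

theorem Coefficients.hasDerivAt_coeff_zero (h : Coefficients V W A φ γ r M n) (hn : n ≠ 0)
    (hX : IsFlow V X) (x : E) (t : ℝ) :
    HasDerivAt (coeff X W A φ 0 x) (drift V (fun y => coeff X W A φ 0 y t) x) t := by
  obtain ⟨K, hK⟩ := h.field.lipschitz
  have := hX.hasDerivAt_of_along hK (w := coeff X W A φ 0) (g := fun _ _ => 0)
    (by exact_mod_cast h.contDiff_coeff hn hX 0 (m := 1) (by omega)) (fun y t => ?_) x t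
  · simpa using this
  · have e : ∀ t, X (X y (-t)) t = y := fun t => by rw [← hX.add hK]; simp [hX.zero]
    simp only [coeff, e]
    exact hasDerivAt_const _ _

theorem Coefficients.hasDerivAt_coeff_succ (h : Coefficients V W A φ γ r M n)
    (hX : IsFlow V X) {l : ℕ} (hl : 1 + 2 * (l + 1) ≤ n) (x : E) (t : ℝ) :
    HasDerivAt (coeff X W A φ (l + 1) x) (drift V (fun y => coeff X W A φ (l + 1) y t) x +
      secondOrder W A (fun y => coeff X W A φ l y t) x) t := by
  obtain ⟨K, hK⟩ := h.field.lipschitz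
  have hXc := h.field.contDiff_flow (by omega) hX
  exact hX.hasDerivAt_duhamel hK (hXc.of_le (by norm_cast; omega))
    (g := fun x t => secondOrder W A (fun y => coeff X W A φ l y t) x)
    (by
      have := h.contDiff_secondOrder (m := 1) (by omega)
        (h.contDiff_coeff (by omega) hX l (m := 1 + 2) (by omega))
      exact_mod_cast this) x t

end Expansion

end SGDExpansion

namespace SGDExpansion

open Filter Topology
open scoped NNReal

set_option maxSynthPendingDepth 4

/-! ### Decay of the coefficients and of their time derivatives -/

section ExpansionDecay

theorem integral_exp_neg_mul_le {δ : ℝ} (hδ : 0 < δ) (t : ℝ) :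
    ∫ s in (0 : ℝ)..t, Real.exp (-δ * s) ≤ 1 / δ := by
  have h : ∀ s, HasDerivAt (fun s => -(Real.exp (-δ * s) / δ)) (Real.exp (-δ * s)) s := by
    intro s
    have := ((((hasDerivAt_id s).const_mul (-δ)).exp).div_const δ).neg
    convert! this using 1
    simp only [id, mul_one]
    field_simp
  rw [intervalIntegral.integral_eq_sub_of_hasDerivAt (fun s _ => h s)
    ((by fun_prop : Continuous fun s => Real.exp (-δ * s)).intervalIntegrable _ _)]
  have : 0 ≤ Real.exp (-δ * t) / δ := by positivity
  simp only [mul_zero, Real.exp_zero]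
  linarith

variable {E : Type} [NormedAddCommGroup E] [InnerProductSpace ℝ E] [FiniteDimensional ℝ E]
  {V W : E → E} {A : E → (E →L[ℝ] E →L[ℝ] ℝ) →L[ℝ] ℝ} {φ : E → ℝ} {γ r M : ℝ} {n : ℕ}
  {X : E → ℝ → E}

theorem DissipativeField.decay_comp_flow (hγ : 0 < γ) (hV : DissipativeField V γ r M n)
    (hn : n ≠ 0) (hX : IsFlow V X) {cX : ℝ} (hcX : 1 ≤ cX)
    (hXb : ∀ x ∈ ball (0 : E) r, ∀ t : ℝ, 0 ≤ t → ∀ j, 1 ≤ j → j ≤ n →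
      ‖iteratedFDeriv ℝ j (fun y => X y t) x‖ ≤ cX * Real.exp (-γ * t))
    {g : E → ℝ} {m : ℕ} (hm : m ≤ n) (hg : ContDiff ℝ m g) {c : ℝ}
    (hgb : ∀ x ∈ ball (0 : E) r, ∀ j ≤ m, ‖iteratedFDeriv ℝ j g x‖ ≤ c) {x : E}
    (hx : x ∈ ball (0 : E) r) {t : ℝ} (ht : 0 ≤ t) {j : ℕ} (hj1 : 1 ≤ j) (hj : j ≤ m) :
    ‖iteratedFDeriv ℝ j (fun y => g (X y t)) x‖ ≤ m.factorial * c * cX ^ m * Real.exp (-γ * t) := by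
  have hXc := hV.contDiff_flow hn hX
  have hc : 0 ≤ c := (norm_nonneg _).trans (hgb x hx 0 (Nat.zero_le _))
  have h1 := norm_iteratedFDeriv_comp_le_of_decay (f := fun y => X y t) (x := x) (s := γ * t) hj1
    (hg.of_le (by exact_mod_cast hj))
    ((contDiff_slice hXc t).of_le (by norm_cast; omega)) hcX (by positivity)
    (fun i hi => hgb _ (hV.mem_ball hX hx ht) i (hi.trans hj))
    (fun i hi1 hi => by simpa using hXb x hx t ht i hi1 (by omega))
  rw [← neg_mul] at h1
  have e4 : (j.factorial : ℝ) ≤ m.factorial := by exact_mod_cast Nat.factorial_le hj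
  have e5 : cX ^ j ≤ cX ^ m := pow_le_pow_right₀ hcX hj
  refine h1.trans ?_
  gcongr

/-- Composition with the flow supplies `e^{-γ(t-s)}` and the source supplies `e^{-as}`. When `a = γ`
the integral over `[0,t]` is of size `t e^{-at}`, so the rate is lowered to `a'` and the integral of
`e^{-(a-a')s}` pays `1 / (a - a')`. -/
theorem DissipativeField.decay_duhamel (hγ : 0 < γ) (hV : DissipativeField V γ r M n)
    (hn : n ≠ 0) (hX : IsFlow V X) {cX : ℝ} (hcX : 1 ≤ cX)
    (hXb : ∀ x ∈ ball (0 : E) r, ∀ t : ℝ, 0 ≤ t → ∀ j, 1 ≤ j → j ≤ n →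
      ‖iteratedFDeriv ℝ j (fun y => X y t) x‖ ≤ cX * Real.exp (-γ * t))
    {g : E → ℝ → ℝ} {m : ℕ} (hm : m ≤ n) {a a' c : ℝ} (hc : 0 ≤ c) (ha : a ≤ γ) (ha' : a' < a)
    (hg : Decay r a c 0 m g) :
    Decay r a' (m.factorial * c * cX ^ m / (a - a')) 1 m
      (fun x t => ∫ s in (0 : ℝ)..t, g (X x (t - s)) s) where
  contDiff := contDiff_duhamel ((hV.contDiff_flow hn hX).of_le (by exact_mod_cast hm)) hg.contDiff
  bound x hx t ht j hj1 hj := by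
    have hXc := hV.contDiff_flow hn hX
    have hδ : 0 < a - a' := sub_pos.2 ha'
    have hcX0 : 0 ≤ cX := zero_le_one.trans hcX
    have hGc : ContDiff ℝ m (fun p : E × ℝ => g (X p.1 (t - p.2)) p.2) := by
      have h1 : ContDiff ℝ m (fun p : E × ℝ => X p.1 (t - p.2)) :=
        (hXc.of_le (by exact_mod_cast hm)).comp (g := fun p : E × ℝ => X p.1 p.2)
          (f := fun p : E × ℝ => (p.1, t - p.2)) (by fun_prop)
      exact hg.contDiff.comp (g := fun p : E × ℝ => g p.1 p.2)
        (f := fun p : E × ℝ => (X p.1 (t - p.2), p.2)) (h1.prodMk contDiff_snd)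
    rw [iteratedFDeriv_intervalIntegral (F := fun x s => g (X x (t - s)) s) 0 t j hj hGc x]
    have hle : ∀ s ∈ Ioc (0 : ℝ) t, ‖iteratedFDeriv ℝ j (fun y => g (X y (t - s)) s) x‖ ≤
        m.factorial * c * cX ^ m * Real.exp (-a' * t) * Real.exp (-(a - a') * s) := by
      intro s hs
      have h1 := hV.decay_comp_flow hγ hn hX hcX hXb hm (contDiff_slice hg.contDiff s)
        (c := c * Real.exp (-a * s)) (fun x hx i hi => hg.bound x hx s hs.1.le i (Nat.zero_le _) hi)
        hx (t := t - s) (by linarith [hs.2]) hj1 hj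
      refine h1.trans ?_
      have h2 : Real.exp (-a * s) * Real.exp (-γ * (t - s)) ≤
          Real.exp (-a' * t) * Real.exp (-(a - a') * s) := by
        rw [← Real.exp_add, ← Real.exp_add, Real.exp_le_exp]
        nlinarith [hs.2]
      calc _ = m.factorial * c * cX ^ m * (Real.exp (-a * s) * Real.exp (-γ * (t - s))) := by ring
        _ ≤ m.factorial * c * cX ^ m * (Real.exp (-a' * t) * Real.exp (-(a - a') * s)) := by gcongr
        _ = _ := by ring
    have hint := intervalIntegral.norm_integral_le_of_norm_le (μ := volume) ht
      (Eventually.of_forall hle) ((by fun_prop : Continuous fun s =>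
        m.factorial * c * cX ^ m * Real.exp (-a' * t) * Real.exp (-(a - a') * s)).intervalIntegrable _ _)
    refine hint.trans ?_
    rw [intervalIntegral.integral_const_mul]
    calc _ ≤ m.factorial * c * cX ^ m * Real.exp (-a' * t) * (1 / (a - a')) :=
          mul_le_mul_of_nonneg_left (integral_exp_neg_mul_le hδ t) (by positivity)
      _ = _ := by ring

theorem exists_coeff_decay (E : Type) [NormedAddCommGroup E] [InnerProductSpace ℝ E]
    [FiniteDimensional ℝ E] {γ : ℝ} (hγ : 0 < γ) {n : ℕ} (hn : n ≠ 0) (l : ℕ) :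
    2 * l ≤ n → ∀ a < γ, ∃ C : ℝ, ∃ p : ℕ, 0 ≤ C ∧
    ∀ (V W : E → E) (A : E → (E →L[ℝ] E →L[ℝ] ℝ) →L[ℝ] ℝ) (φ : E → ℝ) (X : E → ℝ → E) (r M : ℝ),
      Coefficients V W A φ γ r M n → IsFlow V X →
      Decay r a (C * M ^ p) 1 (n - 2 * l) (coeff X W A φ l) := by
  obtain ⟨CX, pX, hCX, hflow⟩ := exists_flow_decay E hγ n n le_rfl
  induction l with
  | zero =>
    intro _ a ha
    refine ⟨n.factorial * CX ^ n, 1 + pX * n, by positivity, fun V W A φ X r M h hX => ?_⟩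
    have hM := h.field.one_le
    refine ⟨h.contDiff_coeff hn hX 0 (by omega), fun x hx t ht j hj1 hj => ?_⟩
    have h1 := h.field.decay_comp_flow hγ hn hX
      (one_le_mul_of_one_le_of_one_le hCX (one_le_pow₀ hM (n := pX)))
      (hflow V X r M h.field hX) le_rfl h.contDiff_φ h.bound_φ hx ht hj1 hj
    refine h1.trans ?_
    calc _ = n.factorial * CX ^ n * M ^ (1 + pX * n) * Real.exp (-γ * t) := by
          rw [pow_add, pow_mul, mul_pow]; ring
      _ ≤ _ := by
          refine mul_le_mul_of_nonneg_left ?_ (by positivity)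
          rw [Real.exp_le_exp]
          nlinarith
  | succ l ih =>
    intro hl a ha
    -- Every stage loses some rate, so the previous coefficient is used at the rate halfway between
    -- `a` and `γ`. This is why the induction carries all `a < γ`.
    obtain ⟨C, p, hC, hdec⟩ := ih (by omega) ((a + γ) / 2) (by linarith)
    set m := n - 2 * (l + 1) with hm
    refine ⟨m.factorial * (2 ^ (m + 1) * C) * CX ^ m / ((a + γ) / 2 - a), 1 + p + pX * m, ?_,
      fun V W A φ X r M h hX => ?_⟩
    · have : 0 < (a + γ) / 2 - a := by linarith
      positivity
    have hM := h.field.one_le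
    have hM0 : 0 ≤ M := by linarith
    have h1 := (hdec V W A φ X r M h hX)
    rw [show n - 2 * l = m + 2 by omega] at h1
    have h2 := h.decay_secondOrder (by omega) (by positivity) h1
    have h3 := h.field.decay_duhamel hγ hn hX
      (one_le_mul_of_one_le_of_one_le hCX (one_le_pow₀ hM (n := pX)))
      (hflow V X r M h.field hX) (by omega) (by positivity) (by linarith)
      (by linarith : a < (a + γ) / 2) h2
    refine h3.mono (le_of_eq ?_) le_rfl le_rfl
    rw [pow_add, pow_add, pow_mul, mul_pow]
    ring

/-- A time derivative of `u_{l+1}` is exchanged for `V·∇u_{l+1}`, which costs one derivative, plus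
the second order operator on `u_l`, which costs two but acts on a coefficient with two more to
spare. The net loss is one order per time derivative. -/
theorem exists_iteratedDeriv_coeff_decay (E : Type) [NormedAddCommGroup E] [InnerProductSpace ℝ E]
    [FiniteDimensional ℝ E] {γ : ℝ} (hγ : 0 < γ) {n : ℕ} (hn : n ≠ 0) {a : ℝ} (ha : a < γ) (i : ℕ) :
    ∀ l, i + 2 * l ≤ n → ∃ C : ℝ, ∃ p : ℕ, 0 ≤ C ∧
    ∀ (V W : E → E) (A : E → (E →L[ℝ] E →L[ℝ] ℝ) →L[ℝ] ℝ) (φ : E → ℝ) (X : E → ℝ → E) (r M : ℝ),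
      Coefficients V W A φ γ r M n → IsFlow V X →
      Decay r a (C * M ^ p) 1 (n - 2 * l - i)
        (fun x t => iteratedDeriv i (coeff X W A φ l x) t) := by
  induction i with
  | zero =>
    intro l hl
    simpa using exists_coeff_decay E hγ hn l (by omega) a ha
  | succ i ih =>
    intro l hl
    obtain ⟨C, p, hC, hdec⟩ := ih l (by omega)
    rcases l with _ | l
    · refine ⟨2 ^ (n - i - 1) * C, p + 1, by positivity, fun V W A φ X r M h hX => ?_⟩
      have hM := h.field.one_le
      have h1 := hdec V W A φ X r M h hX
      have e : (fun x t => iteratedDeriv (i + 1) (coeff X W A φ 0 x) t) = fun x t =>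
          drift V (fun y => iteratedDeriv i (coeff X W A φ 0 y) t) x := by
        funext x t
        rw [iteratedDeriv_succ', funext fun t => (h.hasDerivAt_coeff_zero hn hX x t).deriv]
        exact iteratedDeriv_drift V x i (h.contDiff_coeff hn hX 0 (by omega)) t
      rw [e]
      rw [show n - 2 * 0 - i = n - i - 1 + 1 by omega] at h1
      have h2 := h1.drift (V := V) (M := M) (h.field.contDiff.of_le (by norm_cast; omega))
        (fun x hx j hj => h.field.bound x hx j (by omega)) (by linarith) (by positivity)
      refine h2.mono (le_of_eq ?_) (by omega) (by omega)
      ring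
    · obtain ⟨C', p', hC', hdec'⟩ := ih l (by omega)
      set m := n - 2 * (l + 1) - (i + 1) with hm
      refine ⟨2 ^ m * C + 2 ^ (m + 1) * C', p + p' + 1, by positivity,
        fun V W A φ X r M h hX => ?_⟩
      have hM := h.field.one_le
      have h1 := hdec V W A φ X r M h hX
      have h1' := hdec' V W A φ X r M h hX
      have e : (fun x t => iteratedDeriv (i + 1) (coeff X W A φ (l + 1) x) t) = fun x t =>
          drift V (fun y => iteratedDeriv i (coeff X W A φ (l + 1) y) t) x +
          secondOrder W A (fun y => iteratedDeriv i (coeff X W A φ l y) t) x := by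
        funext x t
        have c1 : ContDiff ℝ (i + 1 : ℕ) (fun p : E × ℝ => coeff X W A φ (l + 1) p.1 p.2) :=
          h.contDiff_coeff hn hX _ (by omega)
        have c2 : ContDiff ℝ (i + 2 : ℕ) (fun p : E × ℝ => coeff X W A φ l p.1 p.2) :=
          h.contDiff_coeff hn hX _ (by omega)
        have d1 : ContDiff ℝ i (fun t => drift V (fun y => coeff X W A φ (l + 1) y t) x) :=
          contDiff_time (w := fun x t => drift V (fun y => coeff X W A φ (l + 1) y t) x)
            (contDiff_drift (h.field.contDiff.of_le (by norm_cast; omega)) c1) x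
        have d2 : ContDiff ℝ i (fun t => secondOrder W A (fun y => coeff X W A φ l y t) x) :=
          contDiff_time (w := fun x t => secondOrder W A (fun y => coeff X W A φ l y t) x)
            (h.contDiff_secondOrder (by omega) c2) x
        rw [iteratedDeriv_succ',
          funext fun t => (h.hasDerivAt_coeff_succ hX (l := l) (by omega) x t).deriv,
          iteratedDeriv_fun_add d1.contDiffAt d2.contDiffAt, iteratedDeriv_drift V x i c1,
          h.iteratedDeriv_secondOrder (by omega) c2]
      rw [e]
      rw [show n - 2 * (l + 1) - i = m + 1 by omega] at h1
      rw [show n - 2 * l - i = m + 1 + 2 by omega] at h1'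
      have h2 := h1.drift (V := V) (M := M) (h.field.contDiff.of_le (by norm_cast; omega))
        (fun x hx j hj => h.field.bound x hx j (by omega)) (by linarith) (by positivity)
      have h3 := h.decay_secondOrder (m := m) (by omega) (by positivity)
        (h1'.mono le_rfl (by omega) le_rfl)
      refine (h2.add h3).mono ?_ le_rfl (by omega)
      have p1 : M ^ p * M ≤ M ^ (p + p' + 1) := by
        rw [← pow_succ]; exact pow_le_pow_right₀ hM (by omega)
      have p2 : M ^ p' * M ≤ M ^ (p + p' + 1) := by
        rw [← pow_succ]; exact pow_le_pow_right₀ hM (by omega)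
      calc _ = 2 ^ m * C * (M ^ p * M) + 2 ^ (m + 1) * C' * (M ^ p' * M) := by ring
        _ ≤ 2 ^ m * C * M ^ (p + p' + 1) + 2 ^ (m + 1) * C' * M ^ (p + p' + 1) := by gcongr
        _ = _ := by ring

end ExpansionDecay

/-! ### The equation for the truncated series and the decay of the residual -/

section Residual

/-- The truncated series `∑_{l ≤ N} η^l u_l`. -/
def partialSum {E : Type*} (η : ℝ) (u : ℕ → E → ℝ → ℝ) (N : ℕ) (x : E) (t : ℝ) : ℝ :=
  ∑ l ∈ Finset.range (N + 1), η ^ l * u l x t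

theorem partialSum_succ {E : Type*} (η : ℝ) (u : ℕ → E → ℝ → ℝ) (N : ℕ) (x : E) (t : ℝ) :
    partialSum η u (N + 1) x t = partialSum η u N x t + η ^ (N + 1) * u (N + 1) x t :=
  Finset.sum_range_succ _ _

variable {E : Type} [NormedAddCommGroup E] [InnerProductSpace ℝ E] [FiniteDimensional ℝ E]
  {V W : E → E} {A : E → (E →L[ℝ] E →L[ℝ] ℝ) →L[ℝ] ℝ} {φ : E → ℝ} {γ r M : ℝ} {n : ℕ}
  {X : E → ℝ → E}

theorem Coefficients.contDiff_partialSum (h : Coefficients V W A φ γ r M n) (hn : n ≠ 0)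
    (hX : IsFlow V X) (η : ℝ) (N : ℕ) {m : ℕ} (hm : m + 2 * N ≤ n) :
    ContDiff ℝ m (fun p : E × ℝ => partialSum η (coeff X W A φ) N p.1 p.2) :=
  ContDiff.sum fun l hl => contDiff_const.mul
    (h.contDiff_coeff hn hX l (by have := Finset.mem_range.1 hl; omega))

/-- The defects telescope: adding `η^{N+1} u_{N+1}` contributes the source term that cancels the
previous defect, and leaves one of the next order. -/
theorem Coefficients.hasDerivAt_partialSum (h : Coefficients V W A φ γ r M n) (hX : IsFlow V X)
    (η : ℝ) (N : ℕ) (hN : 2 + 2 * N ≤ n) (x : E) (t : ℝ) :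
    HasDerivAt (partialSum η (coeff X W A φ) N x)
      (perturbed V W A η (fun y => partialSum η (coeff X W A φ) N y t) x -
        η ^ (N + 1) * secondOrder W A (fun y => coeff X W A φ N y t) x) t := by
  have hn : n ≠ 0 := by omega
  induction N with
  | zero =>
    have e : partialSum η (coeff X W A φ) 0 = coeff X W A φ 0 := by
      funext x t
      simp [partialSum]
    rw [e]
    simpa [perturbed] using h.hasDerivAt_coeff_zero hn hX x t
  | succ N ih =>
    have h1 := (ih (by omega)).add ((h.hasDerivAt_coeff_succ hX (l := N) (by omega) x t).const_mul
      (η ^ (N + 1)))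
    have c1 : ContDiff ℝ 2 (fun y => partialSum η (coeff X W A φ) N y t) :=
      contDiff_slice (by exact_mod_cast h.contDiff_partialSum hn hX η N (m := 2) (by omega)) t
    have c2 : ContDiff ℝ 2 (fun y => coeff X W A φ (N + 1) y t) :=
      contDiff_slice (by exact_mod_cast h.contDiff_coeff hn hX (N + 1) (m := 2) (by omega)) t
    have e : partialSum η (coeff X W A φ) (N + 1) x =
        partialSum η (coeff X W A φ) N x + fun t => η ^ (N + 1) * coeff X W A φ (N + 1) x t := by
      funext t
      exact partialSum_succ _ _ _ _ _
    rw [e]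
    simp only [partialSum_succ]
    rw [perturbed_add_const_mul V W A _ η x c1 c2]
    convert! h1 using 1
    simp only [perturbed]
    ring

theorem Coefficients.iteratedDeriv_partialSum_succ (h : Coefficients V W A φ γ r M n)
    (hX : IsFlow V X) (η : ℝ) (N : ℕ) {j : ℕ} (hj : j + 2 + 2 * N ≤ n) (x : E) (t : ℝ) :
    iteratedDeriv (j + 1) (partialSum η (coeff X W A φ) N x) t =
      perturbed V W A η (fun y => iteratedDeriv j (partialSum η (coeff X W A φ) N y) t) x -
        η ^ (N + 1) * secondOrder W A (fun y => iteratedDeriv j (coeff X W A φ N y) t) x := by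
  have hn : n ≠ 0 := by omega
  have c1 := h.contDiff_partialSum hn hX η N (m := j + 2) hj
  have c2 := h.contDiff_coeff hn hX N (m := j + 2) hj
  have hs := h.contDiff_secondOrder (m := j) (by omega) c1
  have hd : ContDiff ℝ j
      (fun t => perturbed V W A η (fun y => partialSum η (coeff X W A φ) N y t) x) := by
    have d1 := contDiff_drift (m := j) (h.field.contDiff.of_le (by norm_cast; omega))
      (c1.of_le (by norm_cast; omega))
    exact contDiff_time (w := fun x t =>
      perturbed V W A η (fun y => partialSum η (coeff X W A φ) N y t) x)
      (d1.add (contDiff_const.mul hs)) x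
  have hs2 : ContDiff ℝ j (fun t => η ^ (N + 1) * secondOrder W A (fun y => coeff X W A φ N y t) x) :=
    contDiff_time (w := fun x t => η ^ (N + 1) * secondOrder W A (fun y => coeff X W A φ N y t) x)
      (contDiff_const.mul (h.contDiff_secondOrder (by omega) c2)) x
  rw [iteratedDeriv_succ', funext fun t => (h.hasDerivAt_partialSum hX η N (by omega) x t).deriv,
    iteratedDeriv_fun_sub hd.contDiffAt hs2.contDiffAt, h.iteratedDeriv_perturbed (by omega) c1,
    iteratedDeriv_const_mul_field, h.iteratedDeriv_secondOrder (by omega) c2]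

/-- Each step applies the perturbed operator to the previous residual, losing two derivatives, and
adds a defect that already carries `η^{N+1}`. The bound `η₀` only serves to make the factor `1 + η`
a constant. -/
theorem exists_residual_decay (E : Type) [NormedAddCommGroup E] [InnerProductSpace ℝ E]
    [FiniteDimensional ℝ E] {γ : ℝ} (hγ : 0 < γ) {N k : ℕ} (hk : 1 ≤ k) {a : ℝ} (ha : a < γ)
    {η₀ : ℝ} (hη₀ : 0 ≤ η₀) (j : ℕ) (hj : j ≤ k) : ∃ C : ℝ, ∃ p : ℕ, 0 ≤ C ∧
    ∀ (V W : E → E) (A : E → (E →L[ℝ] E →L[ℝ] ℝ) →L[ℝ] ℝ) (φ : E → ℝ) (X : E → ℝ → E) (r M η : ℝ),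
      Coefficients V W A φ γ r M (2 * k + 2 * N) → IsFlow V X → 0 ≤ η → η ≤ η₀ →
      Decay r a (C * M ^ p * η ^ (N + 1)) 0 (2 * k - 2 * j) (fun x t =>
        iteratedDeriv j (partialSum η (coeff X W A φ) N x) t -
          (perturbed V W A η)^[j] (fun y => partialSum η (coeff X W A φ) N y t) x) := by
  induction j with
  | zero =>
    refine ⟨0, 0, le_rfl, fun V W A φ X r M η h hX _ _ => ?_⟩
    have e : (fun (x : E) (t : ℝ) => iteratedDeriv 0 (partialSum η (coeff X W A φ) N x) t -
        (perturbed V W A η)^[0] (fun y => partialSum η (coeff X W A φ) N y t) x) =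
        fun _ _ => 0 := by
      funext x t; simp
    rw [e]
    refine ⟨contDiff_const, fun x _ t _ j _ _ => ?_⟩
    simp
  | succ j ih =>
    obtain ⟨C, p, hC, hres⟩ := ih (by omega)
    obtain ⟨C', p', hC', hdec⟩ := exists_iteratedDeriv_coeff_decay E hγ (n := 2 * k + 2 * N)
      (by omega) ha j N (by omega)
    set m := 2 * k - 2 * (j + 1) with hm
    refine ⟨(1 + η₀) * (2 ^ (m + 1) * C) + 2 ^ (m + 1) * C', p + p' + 1, by positivity,
      fun V W A φ X r M η h hX hη hη' => ?_⟩
    have hn : 2 * k + 2 * N ≠ 0 := by omega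
    have hM := h.field.one_le
    have hM0 : 0 ≤ M := by linarith
    have h1 := hres V W A φ X r M η h hX hη hη'
    have h2 := hdec V W A φ X r M h hX
    rw [show 2 * k - 2 * j = m + 2 by omega] at h1
    have e : (fun (x : E) (t : ℝ) => iteratedDeriv (j + 1) (partialSum η (coeff X W A φ) N x) t -
        (perturbed V W A η)^[j + 1] (fun y => partialSum η (coeff X W A φ) N y t) x) =
        fun x t => perturbed V W A η (fun y =>
          iteratedDeriv j (partialSum η (coeff X W A φ) N y) t -
          (perturbed V W A η)^[j] (fun y => partialSum η (coeff X W A φ) N y t) y) x +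
          -η ^ (N + 1) * secondOrder W A (fun y => iteratedDeriv j (coeff X W A φ N y) t) x := by
      funext x t
      rw [h.iteratedDeriv_partialSum_succ hX η N (by omega), Function.iterate_succ_apply']
      have c1 : ContDiff ℝ 2 (fun y => iteratedDeriv j (partialSum η (coeff X W A φ) N y) t) :=
        contDiff_slice (w := fun y t => iteratedDeriv j (partialSum η (coeff X W A φ) N y) t)
          (contDiff_iteratedDeriv_time (m := 2) j
            (h.contDiff_partialSum hn hX η N (m := 2 + j) (by omega))) t
      have c2 : ContDiff ℝ 2 (fun y => iteratedDeriv j (partialSum η (coeff X W A φ) N y) t -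
          (perturbed V W A η)^[j] (fun y => partialSum η (coeff X W A φ) N y t) y) :=
        (contDiff_slice (w := fun x t => iteratedDeriv j (partialSum η (coeff X W A φ) N x) t -
          (perturbed V W A η)^[j] (fun y => partialSum η (coeff X W A φ) N y t) x)
          h1.contDiff t).of_le (by exact_mod_cast (by omega : 2 ≤ m + 2))
      -- The regularity of the iterated operator is not proved separately: the iterate is the time
      -- derivative minus the residual, and both of these are known to be `C²` in space.
      have e2 : (perturbed V W A η)^[j] (fun y => partialSum η (coeff X W A φ) N y t) =
          fun y => iteratedDeriv j (partialSum η (coeff X W A φ) N y) t + (-1) *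
            (iteratedDeriv j (partialSum η (coeff X W A φ) N y) t -
            (perturbed V W A η)^[j] (fun y => partialSum η (coeff X W A φ) N y t) y) := by
        funext y; ring
      have e3 := perturbed_add_const_mul V W A (-1) η x c1 c2
      rw [← e2] at e3
      rw [e3]
      ring
    rw [e]
    have h3 := h.decay_perturbed (m := m) (by omega) (by positivity) hη
      (h1.mono le_rfl le_rfl (by omega : 0 ≤ 1))
    have h4 := (h.decay_secondOrder (m := m) (by omega) (by positivity)
      (h2.mono le_rfl (by omega) le_rfl)).const_mul (-η ^ (N + 1))
    refine (h3.add h4).mono ?_ le_rfl le_rfl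
    rw [abs_neg, abs_of_nonneg (by positivity)]
    have p1 : M ^ p * M ≤ M ^ (p + p' + 1) := by
      rw [← pow_succ]; exact pow_le_pow_right₀ hM (by omega)
    have p2 : M ^ p' * M ≤ M ^ (p + p' + 1) := by
      rw [← pow_succ]; exact pow_le_pow_right₀ hM (by omega)
    calc _ = ((1 + η) * (2 ^ (m + 1) * C) * (M ^ p * M) + 2 ^ (m + 1) * C' * (M ^ p' * M)) *
          η ^ (N + 1) := by ring
      _ ≤ ((1 + η₀) * (2 ^ (m + 1) * C) * M ^ (p + p' + 1) +
          2 ^ (m + 1) * C' * M ^ (p + p' + 1)) * η ^ (N + 1) := by gcongr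
      _ = _ := by ring

end Residual

end SGDExpansion

namespace SGDExpansion
open Filter Topology
open scoped NNReal
set_option maxSynthPendingDepth 4

/-! ### Strong convexity, monotone gradients and dissipativity -/

section Convexity

variable {E : Type*} [NormedAddCommGroup E] [InnerProductSpace ℝ E] [CompleteSpace E]

/-- Divide the strong convexity inequality on the segment from `x` to `y` by the parameter, and let
it tend to `0` from the right. -/
theorem _root_.StrongConvexOn.add_inner_gradient_le {s : Set E} {γ : ℝ} {F : E → ℝ}
    (hF : StrongConvexOn s γ F) {x y g : E} (hx : x ∈ s) (hy : y ∈ s) (hg : HasGradientAt F g x) :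
    F x + inner ℝ g (y - x) + γ / 2 * ‖x - y‖ ^ 2 ≤ F y := by
  have h1 : HasDerivAt (fun t : ℝ => F (x + t • (y - x))) (inner ℝ g (y - x)) 0 := by
    have h2 : HasDerivAt (fun t : ℝ => x + t • (y - x)) (y - x) 0 := by
      simpa using ((hasDerivAt_id (0 : ℝ)).smul_const (y - x)).const_add x
    have h3 : HasFDerivAt F (InnerProductSpace.toDual ℝ E g) (x + (0 : ℝ) • (y - x)) := by
      simpa using hg.hasFDerivAt
    simpa [Function.comp_def] using h3.comp_hasDerivAt (0 : ℝ) h2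
  have h4 := h1.tendsto_slope_zero_right
  have h5 : Tendsto (fun t : ℝ => F y - F x - (1 - t) * (γ / 2 * ‖x - y‖ ^ 2)) (𝓝[>] 0)
      (𝓝 (F y - F x - (1 - 0) * (γ / 2 * ‖x - y‖ ^ 2))) := by
    apply Tendsto.mono_left _ nhdsWithin_le_nhds
    exact Continuous.tendsto (by fun_prop) _
  have h6 : ∀ᶠ t : ℝ in 𝓝[>] 0, t⁻¹ • (F (x + (0 + t) • (y - x)) - F (x + (0 : ℝ) • (y - x))) ≤
      F y - F x - (1 - t) * (γ / 2 * ‖x - y‖ ^ 2) := by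
    filter_upwards [Ioo_mem_nhdsGT (zero_lt_one (α := ℝ))] with t ht
    have h7 := hF.2 hx hy (sub_nonneg.2 ht.2.le) ht.1.le (by ring)
    have e : (1 - t) • x + t • y = x + (0 + t) • (y - x) := by module
    rw [e] at h7
    simp only [smul_eq_mul, zero_smul, add_zero] at h7 ⊢
    rw [inv_mul_le_iff₀ ht.1]
    linarith
  have h8 := le_of_tendsto_of_tendsto h4 h5 h6
  linarith

theorem _root_.StrongConvexOn.inner_gradient_sub {s : Set E} {γ : ℝ} {F : E → ℝ}
    (hF : StrongConvexOn s γ F) {x y g g' : E} (hx : x ∈ s) (hy : y ∈ s)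
    (hg : HasGradientAt F g x) (hg' : HasGradientAt F g' y) :
    γ * ‖x - y‖ ^ 2 ≤ inner ℝ (g - g') (x - y) := by
  have h1 := hF.add_inner_gradient_le hx hy hg
  have h2 := hF.add_inner_gradient_le hy hx hg'
  rw [norm_sub_rev y x] at h2
  have e : inner ℝ g (y - x) = - inner ℝ g (x - y) := by rw [← neg_sub, inner_neg_right]
  rw [inner_sub_left]
  linarith

end Convexity

section Dissipativity

variable {E : Type*} [NormedAddCommGroup E] [InnerProductSpace ℝ E]

/-- Monotonicity is tested on the difference quotients of `G` in direction `v`. This gives the lower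
bound on the Hessian of `f` without second derivatives of the `F ξ`. -/
theorem inner_fderiv_ge_of_monotone {s : Set E} {γ : ℝ} {G : E → E} {x : E} (hs : s ∈ 𝓝 x)
    (hG : DifferentiableAt ℝ G x)
    (hm : ∀ y ∈ s, γ * ‖y - x‖ ^ 2 ≤ inner ℝ (G y - G x) (y - x)) (v : E) :
    γ * ‖v‖ ^ 2 ≤ inner ℝ v (fderiv ℝ G x v) := by
  have h2 : HasDerivAt (fun t : ℝ => x + t • v) v 0 := by
    simpa using ((hasDerivAt_id (0 : ℝ)).smul_const v).const_add x
  have h1 : HasDerivAt (fun t : ℝ => (inner ℝ v (G (x + t • v)) : ℝ))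
      (inner ℝ v (fderiv ℝ G x v)) 0 := by
    have h3 : HasFDerivAt G (fderiv ℝ G x) (x + (0 : ℝ) • v) := by
      simpa using hG.hasFDerivAt
    have h4 := (innerSL ℝ v).hasFDerivAt.comp_hasDerivAt (0 : ℝ) (h3.comp_hasDerivAt (0 : ℝ) h2)
    simpa [Function.comp_def] using h4
  have h4 := h1.tendsto_slope_zero_right
  refine ge_of_tendsto h4 ?_
  have h5 : ∀ᶠ t : ℝ in 𝓝[>] 0, x + t • v ∈ s := by
    have := h2.continuousAt.tendsto.mono_left (nhdsWithin_le_nhds (s := Ioi 0))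
    simp only [zero_smul, add_zero] at this
    exact this hs
  filter_upwards [h5, self_mem_nhdsWithin] with t ht ht0
  have ht0 : 0 < t := ht0
  have h6 := hm _ ht
  simp only [add_sub_cancel_left, norm_smul, inner_smul_right, Real.norm_eq_abs, mul_pow,
    sq_abs] at h6
  simp only [zero_add, zero_smul, add_zero, smul_eq_mul]
  rw [← inner_sub_right, real_inner_comm, le_inv_mul_iff₀ ht0]
  nlinarith

end Dissipativity

/-! ### Cutoff functions -/

section Cutoff

variable {E : Type*} [NormedAddCommGroup E] [InnerProductSpace ℝ E] [FiniteDimensional ℝ E]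
  {G : Type*} [NormedAddCommGroup G] [NormedSpace ℝ G]

theorem contDiff_bump_smul (χ : ContDiffBump (0 : E)) {R : ℝ} (hR : χ.rOut < R) {m : ℕ}
    {g : E → G} (hg : ContDiffOn ℝ m g (ball 0 R)) : ContDiff ℝ m (fun x => χ x • g x) := by
  rw [contDiff_iff_contDiffAt]
  intro x
  by_cases hx : x ∈ ball (0 : E) R
  · exact (χ.contDiff (n := m)).contDiffAt.smul (hg.contDiffAt (isOpen_ball.mem_nhds hx))
  · have h1 : x ∉ tsupport χ := by
      rw [χ.tsupport_eq]
      intro h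
      exact hx (closedBall_subset_ball hR h)
    have h2 : (fun x => χ x • g x) =ᶠ[𝓝 x] fun _ => 0 := by
      filter_upwards [notMem_tsupport_iff_eventuallyEq.1 h1] with y hy
      simp [hy]
    exact contDiffAt_const.congr_of_eventuallyEq h2

theorem hasCompactSupport_bump_smul (χ : ContDiffBump (0 : E)) (g : E → G) :
    HasCompactSupport (fun x => χ x • g x) :=
  χ.hasCompactSupport.smul_right

theorem bump_smul_eventuallyEq (χ : ContDiffBump (0 : E)) {x : E} (hx : x ∈ ball (0 : E) χ.rIn)
    (g : E → G) : (fun x => χ x • g x) =ᶠ[𝓝 x] g := by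
  filter_upwards [χ.eventuallyEq_one_of_mem_ball hx] with y hy
  simp [hy]

end Cutoff

/-! ### Norms of the derivatives of gradients -/

section Gradient

variable {E : Type*} [NormedAddCommGroup E] [InnerProductSpace ℝ E] [CompleteSpace E]

variable (E) in
/-- The Riesz isomorphism as a linear isometry. -/
noncomputable def rieszEquiv : (E →L[ℝ] ℝ) ≃ₗᵢ[ℝ] E where
  toFun := (InnerProductSpace.toDual ℝ E).symm
  invFun := InnerProductSpace.toDual ℝ E
  map_add' := by simp
  map_smul' := by simp
  left_inv := fun x => by simp
  right_inv := fun x => by simp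
  norm_map' := fun x => by simp

theorem gradient_eq_rieszEquiv_comp (f : E → ℝ) :
    gradient f = rieszEquiv E ∘ fderiv ℝ f := rfl

theorem norm_iteratedFDeriv_gradient (f : E → ℝ) (j : ℕ) (x : E) :
    ‖iteratedFDeriv ℝ j (gradient f) x‖ = ‖iteratedFDeriv ℝ (j + 1) f x‖ := by
  rw [gradient_eq_rieszEquiv_comp, LinearIsometryEquiv.norm_iteratedFDeriv_comp_left,
    norm_iteratedFDeriv_fderiv]

theorem contDiffOn_gradient {f : E → ℝ} {s : Set E} (hs : IsOpen s) {m : ℕ}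
    (hf : ContDiffOn ℝ (m + 1 : ℕ) f s) : ContDiffOn ℝ m (gradient f) s := by
  rw [gradient_eq_rieszEquiv_comp]
  exact (rieszEquiv E).toContinuousLinearEquiv.contDiff.comp_contDiffOn
    (hf.fderiv_of_isOpen hs (by norm_cast))

/-- Leibniz's rule for the bilinear inner product at order `j + 1`; the binomial coefficients sum to
`2 ^ (j + 1)`. -/
theorem gradient_norm_sq_bound {G : E → E} {m : ℕ} {x : E} {K : ℝ}
    (hG : ContDiff ℝ (m + 1 : ℕ) G) (hK : ∀ j ≤ m + 1, ‖iteratedFDeriv ℝ j G x‖ ≤ K)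
    {j : ℕ} (hj : j ≤ m) :
    ‖iteratedFDeriv ℝ j (gradient (fun y => ‖G y‖ ^ 2)) x‖ ≤ 2 ^ (j + 1) * K ^ 2 := by
  rw [norm_iteratedFDeriv_gradient]
  have e : (fun y => ‖G y‖ ^ 2) = fun y => innerSL ℝ (G y) (G y) := by
    funext y; simp
  rw [e]
  have hK0 : 0 ≤ K := (norm_nonneg _).trans (hK 0 (by omega))
  have h1 := (innerSL ℝ (E := E)).norm_iteratedFDeriv_le_of_bilinear_of_le_one hG hG x
    (n := j + 1) (by exact_mod_cast (by omega : j + 1 ≤ m + 1)) (norm_innerSL_le ℝ)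
  refine h1.trans ?_
  calc _ ≤ ∑ i ∈ Finset.range (j + 1 + 1), ((j + 1).choose i : ℝ) * K ^ 2 := by
        refine Finset.sum_le_sum fun i hi => ?_
        have hi' : i ≤ j + 1 := by simpa [Nat.lt_succ_iff] using hi
        rw [mul_assoc, sq]
        gcongr
        · exact hK i (by omega)
        · exact hK _ (by omega)
    _ = _ := by
        rw [← Finset.sum_mul]
        congr 1
        exact_mod_cast Nat.sum_range_choose (j + 1)

end Gradient

end SGDExpansion

namespace SGDExpansion
open Filter Topology
open scoped NNReal
set_option maxSynthPendingDepth 4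

variable {d : ℕ}

/-! ### From the assumptions on the random functions to global coefficients -/

section Assumption

variable {Ξ : Type*} [MeasurableSpace Ξ] {P : Measure Ξ} {F : Ξ → EuclideanSpace ℝ (Fin d) → ℝ}
  {f : EuclideanSpace ℝ (Fin d) → ℝ} {γ b R₁ : ℝ}

theorem Assumption.gradient_zero (h : Assumption P F f γ b R₁) : gradient f 0 = 0 := by
  rw [(h.unbiased 0).gradient]
  exact (InnerProductSpace.toDual ℝ (EuclideanSpace ℝ (Fin d))).map_eq_zero_iff.1
    (h.localMin.hasFDerivAt_eq_zero (h.unbiased 0).hasFDerivAt)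

/-- Each `gradient (F ξ)` is strongly monotone with the same constant, and the inequality is
preserved by integration over `ξ`, since the gradients are unbiased. -/
theorem Assumption.monotone [IsProbabilityMeasure P] (h : Assumption P F f γ b R₁)
    {x y : EuclideanSpace ℝ (Fin d)} (hx : x ∈ ball (0 : EuclideanSpace ℝ (Fin d)) R₁)
    (hy : y ∈ ball (0 : EuclideanSpace ℝ (Fin d)) R₁) :
    γ * ‖x - y‖ ^ 2 ≤ inner ℝ (gradient f x - gradient f y) (x - y) := by
  have hint : ∀ x, Integrable (fun ξ => gradient (F ξ) x) P :=
    fun x => (h.memLp x).integrable (by norm_num)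
  have hd : ∀ ξ z, HasGradientAt (F ξ) (gradient (F ξ) z) z := fun ξ z =>
    ((h.contDiff ξ).differentiable (by norm_num) z).hasGradientAt
  rw [(h.unbiased x).gradient, (h.unbiased y).gradient, ← integral_sub (hint x) (hint y),
    real_inner_comm, ← integral_inner (f := fun ξ => gradient (F ξ) x - gradient (F ξ) y)
      ((hint x).sub (hint y))]
  have h1 : ∫ _ξ, γ * ‖x - y‖ ^ 2 ∂P = γ * ‖x - y‖ ^ 2 := by simp
  rw [← h1]
  refine integral_mono (integrable_const _) (((hint x).sub (hint y)).const_inner _) fun ξ => ?_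
  have := (h.strongConvex ξ).inner_gradient_sub hx hy (hd ξ x) (hd ξ y)
  rw [real_inner_comm] at this
  exact this

end Assumption

theorem norm_iteratedFDeriv_le_ckNorm {G : Type*} [NormedAddCommGroup G] [NormedSpace ℝ G] {m : ℕ}
    {U : Set (EuclideanSpace ℝ (Fin d))} {g : EuclideanSpace ℝ (Fin d) → G} (hg : MemCk m U g)
    {j : ℕ} (hj : j ≤ m) {x : EuclideanSpace ℝ (Fin d)} (hx : x ∈ U) :
    ‖iteratedFDeriv ℝ j g x‖ ≤ (ckNorm m U g).toReal := by
  rw [← toReal_enorm]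
  refine ENNReal.toReal_mono hg.2.ne ?_
  exact (le_iSup₂ (f := fun x (_ : x ∈ U) => ‖iteratedFDeriv ℝ j g x‖ₑ) x hx).trans
    (le_iSup (fun j : Fin (m + 1) => ⨆ x ∈ U, ‖iteratedFDeriv ℝ (j : ℕ) g x‖ₑ)
      ⟨j, Nat.lt_succ_of_le hj⟩)

variable (d) in
/-- The pairing `(S, B) ↦ ½ Tr(S B)` of a matrix with a bilinear form. -/
noncomputable def tracePairing : (Fin d → Fin d → ℝ) →L[ℝ]
    ((EuclideanSpace ℝ (Fin d) →L[ℝ] EuclideanSpace ℝ (Fin d) →L[ℝ] ℝ) →L[ℝ] ℝ) :=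
  (1 / 2 : ℝ) • ∑ i, ∑ j, ((ContinuousLinearMap.proj (R := ℝ) (φ := fun _ : Fin d => ℝ) j).comp
    (ContinuousLinearMap.proj (R := ℝ) (φ := fun _ : Fin d => Fin d → ℝ) i)).smulRight
    ((ContinuousLinearMap.apply ℝ ℝ (EuclideanSpace.single i (1 : ℝ))).comp
      (ContinuousLinearMap.apply ℝ (EuclideanSpace ℝ (Fin d) →L[ℝ] ℝ)
        (EuclideanSpace.single j (1 : ℝ))))

/-- The order of the basis vectors is that of the matrix product in `Tr(S B)`, so no symmetry of the
Hessian is required. -/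
theorem tracePairing_apply (S : Fin d → Fin d → ℝ)
    (B : EuclideanSpace ℝ (Fin d) →L[ℝ] EuclideanSpace ℝ (Fin d) →L[ℝ] ℝ) :
    tracePairing d S B = 1 / 2 * ∑ i, ∑ j, S i j *
      B (EuclideanSpace.single j 1) (EuclideanSpace.single i 1) := by
  simp [tracePairing]

section Operators

variable {f v : EuclideanSpace ℝ (Fin d) → ℝ}
  {S : EuclideanSpace ℝ (Fin d) → Matrix (Fin d) (Fin d) ℝ}
  {V W : EuclideanSpace ℝ (Fin d) → EuclideanSpace ℝ (Fin d)}
  {A : EuclideanSpace ℝ (Fin d) →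
    (EuclideanSpace ℝ (Fin d) →L[ℝ] EuclideanSpace ℝ (Fin d) →L[ℝ] ℝ) →L[ℝ] ℝ}
  {x : EuclideanSpace ℝ (Fin d)}

theorem L1_eq_drift (hV : V x = -gradient f x) : L1 f v x = drift V v x := by
  rw [L1, drift, hV, map_neg, real_inner_comm, inner_gradient_left]

theorem L2_eq_secondOrder
    (hW : W x = (-(1 / 4) : ℝ) • gradient (fun y => ‖gradient f y‖ ^ 2) x)
    (hA : A x = tracePairing d (fun i j => S x i j)) : L2 f S v x = secondOrder W A v x := by
  rw [L2, secondOrder, drift, diffusion, hW, hA, tracePairing_apply, map_smul, real_inner_comm,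
    inner_gradient_left]
  simp [Matrix.trace, Matrix.mul_apply, hessian]

theorem L1_congr {v w : EuclideanSpace ℝ (Fin d) → ℝ} (h : v =ᶠ[𝓝 x] w) :
    L1 f v x = L1 f w x := by
  rw [L1, L1, h.gradient_eq]

theorem L2_congr {v w : EuclideanSpace ℝ (Fin d) → ℝ} (h : v =ᶠ[𝓝 x] w) :
    L2 f S v x = L2 f S w x := by
  simp only [L2, hessian, h.gradient_eq, h.fderiv.fderiv_eq]

end Operators

/-- The data `V`, `W`, `A` represent `𝓛₁` and `𝓛₂` on the ball of radius `r`. -/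
structure Represents (f : EuclideanSpace ℝ (Fin d) → ℝ)
    (S : EuclideanSpace ℝ (Fin d) → Matrix (Fin d) (Fin d) ℝ) (r : ℝ)
    (V W : EuclideanSpace ℝ (Fin d) → EuclideanSpace ℝ (Fin d))
    (A : EuclideanSpace ℝ (Fin d) →
      (EuclideanSpace ℝ (Fin d) →L[ℝ] EuclideanSpace ℝ (Fin d) →L[ℝ] ℝ) →L[ℝ] ℝ) : Prop where
  first : ∀ x ∈ ball (0 : EuclideanSpace ℝ (Fin d)) r, ∀ v, L1 f v x = drift V v x
  second : ∀ x ∈ ball (0 : EuclideanSpace ℝ (Fin d)) r, ∀ v, L2 f S v x = secondOrder W A v x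

-- The data are cut off outside `B(0,r)` and left unchanged on it, so on that ball all norms are
-- bounded by those of the original data and the constant does not depend on `r`. It is quadratic in
-- the norms because `W` comes from `‖∇f‖²`; the factor `2 ^ n` comes from Leibniz's rule for this
-- square, and `‖tracePairing d‖` from `A`.
set_option maxHeartbeats 1000000 in
theorem exists_coefficients {f φ : EuclideanSpace ℝ (Fin d) → ℝ}
    {S : EuclideanSpace ℝ (Fin d) → Matrix (Fin d) (Fin d) ℝ} {γ r R : ℝ} {n : ℕ} (hn : 2 ≤ n)
    (hγ : 0 ≤ γ) (hr : 0 < r) (hrR : r < R) (hφ : MemCk n (ball 0 R) φ)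
    (hf : MemCk (n + 1) (ball 0 R) f)
    (hS : MemCk (n - 2) (ball 0 R) (fun x => (fun i j => S x i j : Fin d → Fin d → ℝ)))
    (h0 : gradient f 0 = 0)
    (hmono : ∀ x ∈ ball (0 : EuclideanSpace ℝ (Fin d)) R,
      ∀ y ∈ ball (0 : EuclideanSpace ℝ (Fin d)) R,
      γ * ‖x - y‖ ^ 2 ≤ inner ℝ (gradient f x - gradient f y) (x - y)) :
    ∃ V W A φ', Coefficients V W A φ' γ r ((2 ^ n + ‖tracePairing d‖ + 1) *
        (1 + (ckNorm n (ball 0 R) φ).toReal + (ckNorm (n + 1) (ball 0 R) f).toReal +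
          (ckNorm (n - 2) (ball 0 R)
            (fun x => (fun i j => S x i j : Fin d → Fin d → ℝ))).toReal) ^ 2) n ∧
      Represents f S r V W A ∧
      ∀ x ∈ ball (0 : EuclideanSpace ℝ (Fin d)) r, φ' x = φ x := by
  have hφb := fun j (hj : j ≤ n) x hx => norm_iteratedFDeriv_le_ckNorm hφ hj (x := x) hx
  have hfb := fun j (hj : j ≤ n + 1) x hx => norm_iteratedFDeriv_le_ckNorm hf hj (x := x) hx
  have hSb := fun j (hj : j ≤ n - 2) x hx => norm_iteratedFDeriv_le_ckNorm hS hj (x := x) hx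
  set a := (ckNorm n (ball 0 R) φ).toReal with ha
  set b := (ckNorm (n + 1) (ball 0 R) f).toReal with hb
  set c := (ckNorm (n - 2) (ball 0 R)
    (fun x => (fun i j => S x i j : Fin d → Fin d → ℝ))).toReal with hc
  have ha0 : 0 ≤ a := ENNReal.toReal_nonneg
  have hb0 : 0 ≤ b := ENNReal.toReal_nonneg
  have hc0 : 0 ≤ c := ENNReal.toReal_nonneg
  clear_value a b c
  set T := 1 + a + b + c with hT
  have hT1 : 1 ≤ T := by linarith
  have hT2 : T ≤ T ^ 2 := by nlinarith
  have hp : (1 : ℝ) ≤ 2 ^ n := one_le_pow₀ (by norm_num)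
  have hPn := norm_nonneg (tracePairing d)
  have hTM : T ≤ (2 ^ n + ‖tracePairing d‖ + 1) * T ^ 2 := by nlinarith
  let χ : ContDiffBump (0 : EuclideanSpace ℝ (Fin d)) :=
    ⟨r, (r + R) / 2, hr, by linarith⟩
  have hχR : χ.rOut < R := show (r + R) / 2 < R by linarith
  have hsub : ball (0 : EuclideanSpace ℝ (Fin d)) r ⊆ ball 0 R := ball_subset_ball hrR.le
  have hG : ContDiffOn ℝ n (fun x => -gradient f x) (ball 0 R) :=
    (contDiffOn_gradient isOpen_ball hf.1).neg
  let V : EuclideanSpace ℝ (Fin d) → EuclideanSpace ℝ (Fin d) := fun x => χ x • -gradient f x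
  have hVc : ContDiff ℝ n V := contDiff_bump_smul χ hχR hG
  have hVe : ∀ x ∈ ball (0 : EuclideanSpace ℝ (Fin d)) r, V =ᶠ[𝓝 x] fun x => -gradient f x :=
    fun x hx => bump_smul_eventuallyEq χ hx _
  have hVb : ∀ x ∈ ball (0 : EuclideanSpace ℝ (Fin d)) r, ∀ j ≤ n,
      ‖iteratedFDeriv ℝ j V x‖ ≤ b := by
    intro x hx j hj
    rw [((hVe x hx).iteratedFDeriv ℝ j).eq_of_nhds]
    have : iteratedFDeriv ℝ j (fun x => -gradient f x) x = -iteratedFDeriv ℝ j (gradient f) x :=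
      iteratedFDeriv_neg_apply
    rw [this, norm_neg, norm_iteratedFDeriv_gradient]
    exact hfb _ (by omega) x (hsub hx)
  have hn1 : n = (n - 1) + 1 := by omega
  have hVg : ContDiff ℝ (n - 1 : ℕ) (gradient (fun y => ‖V y‖ ^ 2)) := by
    rw [← contDiffOn_univ]
    refine contDiffOn_gradient isOpen_univ (contDiff_norm_sq ℝ |>.comp ?_).contDiffOn
    rw [← hn1]
    exact hVc
  let g : EuclideanSpace ℝ (Fin d) → Fin d → Fin d → ℝ :=
    fun x => χ x • (fun i j => S x i j)
  have hgc : ContDiff ℝ (n - 2 : ℕ) g := contDiff_bump_smul χ hχR hS.1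
  have hge : ∀ x ∈ ball (0 : EuclideanSpace ℝ (Fin d)) r, g =ᶠ[𝓝 x] fun x i j => S x i j :=
    fun x hx => bump_smul_eventuallyEq χ hx _
  let φ' : EuclideanSpace ℝ (Fin d) → ℝ := fun x => χ x • φ x
  have hφc : ContDiff ℝ n φ' := contDiff_bump_smul χ hχR hφ.1
  have hφe : ∀ x ∈ ball (0 : EuclideanSpace ℝ (Fin d)) r, φ' =ᶠ[𝓝 x] φ :=
    fun x hx => bump_smul_eventuallyEq χ hx _
  -- `W` is built from `‖V‖²` with the cut-off `V`, so it is globally smooth without a second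
  -- cutoff, and agrees on `B(0,r)` with the field built from `‖∇f‖²`.
  refine ⟨V, fun x => (-(1 / 4) : ℝ) • gradient (fun y => ‖V y‖ ^ 2) x,
    fun x => tracePairing d (g x), φ', ⟨⟨hVc, ?_, ?_, ?_, ?_, ?_, ?_⟩, ?_, ?_, hφc, ?_, ?_, ?_⟩,
    ⟨?_, ?_⟩, fun x hx => (hφe x hx).eq_of_nhds⟩
  · exact ContDiff.lipschitzWith_of_hasCompactSupport (hasCompactSupport_bump_smul χ _) hVc
      (by exact_mod_cast (by omega : n ≠ 0))
  · obtain ⟨C, hC⟩ := (hasCompactSupport_bump_smul χ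
      (fun x => -gradient f x)).exists_bound_of_continuous hVc.continuous
    exact ⟨C.toNNReal, fun x => (hC x).trans (Real.le_coe_toNNReal C)⟩
  -- The cutoff is nonnegative, so it preserves the sign of `⟨x, -∇f(x)⟩`, and it vanishes outside
  -- `B(0,R)`. Hence the field is inward on the whole space.
  · intro x
    by_cases hx : x ∈ ball (0 : EuclideanSpace ℝ (Fin d)) R
    · have h1 := hmono x hx 0 (mem_ball_self (hr.trans hrR))
      rw [h0, sub_zero, sub_zero] at h1
      have h2 : 0 ≤ inner ℝ (gradient f x) x := le_trans (by positivity) h1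
      rw [real_inner_comm] at h2
      have := mul_nonneg (χ.nonneg (x := x)) h2
      simp only [V, inner_smul_right, inner_neg_right]
      linarith
    · have : χ x = 0 := by
        apply χ.zero_of_le_dist
        rw [mem_ball, not_lt] at hx
        linarith
      simp [V, this]
  · intro x hx v
    rw [(hVe x hx).fderiv_eq, fderiv_fun_neg]
    have hG' : DifferentiableAt ℝ (gradient f) x :=
      ((contDiffOn_gradient isOpen_ball hf.1).contDiffAt
        (isOpen_ball.mem_nhds (hsub hx))).differentiableAt
        (by exact_mod_cast (by omega : n ≠ 0))
    have := inner_fderiv_ge_of_monotone (isOpen_ball.mem_nhds (hsub hx)) hG'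
      (fun y hy => hmono y hy x (hsub hx)) v
    simp only [neg_apply, inner_neg_right]
    linarith
  · nlinarith
  · exact fun x hx j hj => (hVb x hx j hj).trans (by linarith)
  · exact hVg.const_smul _
  · exact (tracePairing d).contDiff.comp hgc
  · intro x hx j hj
    have h1 := gradient_norm_sq_bound (m := n - 1) (x := x) (by rw [← hn1]; exact hVc)
      (fun i hi => hVb x hx i (by omega)) hj
    have h2 : iteratedFDeriv ℝ j (fun x => (-(1 / 4) : ℝ) • gradient (fun y => ‖V y‖ ^ 2) x) x =
        (-(1 / 4) : ℝ) • iteratedFDeriv ℝ j (gradient (fun y => ‖V y‖ ^ 2)) x :=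
      iteratedFDeriv_const_smul_apply' (hVg.of_le (by exact_mod_cast hj)).contDiffAt
    rw [h2, norm_smul]
    have h3 : (2 : ℝ) ^ (j + 1) ≤ 2 ^ n := pow_le_pow_right₀ (by norm_num) (by omega)
    have h4 : b ^ 2 ≤ T ^ 2 := by gcongr; linarith
    have h5 : (2 : ℝ) ^ (j + 1) * b ^ 2 ≤ 2 ^ n * T ^ 2 := by gcongr
    have h6 : ‖(-(1 / 4) : ℝ)‖ ≤ 1 := by norm_num
    have h7 : 0 ≤ ‖tracePairing d‖ * T ^ 2 := by positivity
    nlinarith [norm_nonneg (iteratedFDeriv ℝ j (gradient (fun y => ‖V y‖ ^ 2)) x)]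
  · intro x hx j hj
    have h1 := (tracePairing d).norm_iteratedFDeriv_comp_left (x := x) hgc.contDiffAt
      (n := j) (by exact_mod_cast hj)
    have h2 : ‖iteratedFDeriv ℝ j g x‖ ≤ c := by
      rw [((hge x hx).iteratedFDeriv ℝ j).eq_of_nhds]
      exact hSb j hj x (hsub hx)
    refine h1.trans ?_
    have h3 : ‖tracePairing d‖ * ‖iteratedFDeriv ℝ j g x‖ ≤ ‖tracePairing d‖ * T := by
      gcongr; linarith
    nlinarith
  · intro x hx j hj
    rw [((hφe x hx).iteratedFDeriv ℝ j).eq_of_nhds]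
    exact (hφb j hj x (hsub hx)).trans (by linarith)
  · exact fun x hx v => L1_eq_drift (hVe x hx).eq_of_nhds
  · intro x hx v
    refine L2_eq_secondOrder ?_ ?_
    · have : (fun y => ‖V y‖ ^ 2) =ᶠ[𝓝 x] fun y => ‖gradient f y‖ ^ 2 := by
        filter_upwards [hVe x hx] with y hy
        rw [hy, norm_neg]
      exact congrArg ((-(1 / 4) : ℝ) • ·) this.gradient_eq
    · exact congrArg (tracePairing d) (hge x hx).eq_of_nhds

end SGDExpansion

namespace SGDExpansion
open Filter Topology
open scoped NNReal
set_option maxSynthPendingDepth 4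

/-! ### Identification of classical solutions with the Duhamel coefficients, and conclusion -/

variable {d N n : ℕ} {f φ φ' : EuclideanSpace ℝ (Fin d) → ℝ}
  {S : EuclideanSpace ℝ (Fin d) → Matrix (Fin d) (Fin d) ℝ}
  {V W : EuclideanSpace ℝ (Fin d) → EuclideanSpace ℝ (Fin d)}
  {A : EuclideanSpace ℝ (Fin d) →
    (EuclideanSpace ℝ (Fin d) →L[ℝ] EuclideanSpace ℝ (Fin d) →L[ℝ] ℝ) →L[ℝ] ℝ}
  {X : EuclideanSpace ℝ (Fin d) → ℝ → EuclideanSpace ℝ (Fin d)}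
  {u : ℕ → EuclideanSpace ℝ (Fin d) → ℝ → ℝ} {γ r R M η : ℝ}

theorem Represents.iterate (hS : Represents f S r V W A)
    {v w : EuclideanSpace ℝ (Fin d) → ℝ}
    (h : ∀ x ∈ ball (0 : EuclideanSpace ℝ (Fin d)) r, v x = w x) (η : ℝ) (j : ℕ) :
    ∀ x ∈ ball (0 : EuclideanSpace ℝ (Fin d)) r,
      (LL f S η)^[j] v x = (perturbed V W A η)^[j] w x := by
  induction j with
  | zero => exact h
  | succ j ih =>
    intro x hx
    have e : (LL f S η)^[j] v =ᶠ[𝓝 x] (perturbed V W A η)^[j] w :=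
      Filter.eventually_of_mem (isOpen_ball.mem_nhds hx) ih
    rw [Function.iterate_succ_apply', Function.iterate_succ_apply', LL, perturbed, L1_congr e,
      L2_congr e, hS.first x hx, hS.second x hx]

/-- Uniqueness by characteristics: `s ↦ v (X x (t - s)) s` has derivative `G` and runs from `v₀ (X x
t)` to `v x t`. Differentiability is only used for `0 < s < t`, where the one-sided condition at
time `0` plays no role; `G` is a continuous extension of the source along the trajectory. -/
theorem IsTransportSolution.eq_duhamel {g v : EuclideanSpace ℝ (Fin d) → ℝ → ℝ}
    {v₀ : EuclideanSpace ℝ (Fin d) → ℝ} (hv : IsTransportSolution f R g v₀ v) (hX : IsFlow V X)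
    (hr : r ≤ R)
    (hrX : ∀ x ∈ ball (0 : EuclideanSpace ℝ (Fin d)) r, ∀ t : ℝ, 0 ≤ t → X x t ∈ ball 0 r)
    (hV : ∀ x ∈ ball (0 : EuclideanSpace ℝ (Fin d)) r, ∀ v, L1 f v x = drift V v x)
    {x : EuclideanSpace ℝ (Fin d)} (hx : x ∈ ball 0 r) {t : ℝ} (ht : 0 ≤ t) {G : ℝ → ℝ}
    (hG : Continuous G) (hgG : ∀ s ∈ Ioo 0 t, g (X x (t - s)) s = G s) :
    v x t = v₀ (X x t) + ∫ s in (0 : ℝ)..t, G s := by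
  have hsub := ball_subset_ball (x := (0 : EuclideanSpace ℝ (Fin d))) hr
  have hXc : Continuous (X x) :=
    continuous_iff_continuousAt.2 fun t => (hX.hasDerivAt x t).continuousAt
  have hcont : ContinuousOn (fun s => v (X x (t - s)) s) (Icc 0 t) := by
    refine hv.contDiffOn.continuousOn.comp (f := fun s => (X x (t - s), s))
      (by fun_prop) fun s hs => ?_
    exact ⟨hsub (hrX x hx _ (sub_nonneg.2 hs.2)), hs.1⟩
  have hderiv : ∀ s ∈ Ioo 0 t, HasDerivAt (fun s => v (X x (t - s)) s) (G s) s := by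
    intro s hs
    set y := X x (t - s) with hy
    have hyr : y ∈ ball 0 r := hrX x hx _ (sub_nonneg.2 hs.2.le)
    have hd : HasFDerivAt (fun p : EuclideanSpace ℝ (Fin d) × ℝ => v p.1 p.2)
        (fderiv ℝ (fun p : EuclideanSpace ℝ (Fin d) × ℝ => v p.1 p.2) (y, s)) (y, s) :=
      ((hv.contDiffOn.contDiffAt (prod_mem_nhds (isOpen_ball.mem_nhds (hsub hyr))
        (Ici_mem_nhds hs.1))).differentiableAt one_ne_zero).hasFDerivAt
    set D := fderiv ℝ (fun p : EuclideanSpace ℝ (Fin d) × ℝ => v p.1 p.2) (y, s) with hD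
    have h1 : HasDerivAt (fun s => X x (t - s)) (-(V y)) s := by
      have := (hX.hasDerivAt x (t - s)).scomp s ((hasDerivAt_id s).const_sub t)
      simpa [Function.comp_def, hy] using this
    have h2 : HasDerivAt (fun s => v (X x (t - s)) s) (D (-(V y), 1)) s :=
      HasFDerivAt.comp_hasDerivAt s (f := fun s => (X x (t - s), s)) hd
        (h1.prodMk (hasDerivAt_id s))
    have h3 : fderiv ℝ (fun y => v y s) y = D.comp (.inl ℝ _ ℝ) :=
      (HasFDerivAt.comp y (g := fun p : EuclideanSpace ℝ (Fin d) × ℝ => v p.1 p.2)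
        (f := fun y => (y, s)) hd (hasFDerivAt_prodMk_left _ _)).fderiv
    have h4 : HasDerivAt (v y) (D (0, 1)) s := by
      have : HasFDerivAt (v y) (D.comp (.inr ℝ _ ℝ)) s :=
        HasFDerivAt.comp s (g := fun p : EuclideanSpace ℝ (Fin d) × ℝ => v p.1 p.2)
          (f := fun s => (y, s)) hd (hasFDerivAt_prodMk_right _ _)
      simpa using this.hasDerivAt
    have h5 := h4.unique ((hv.eqn y (hsub hyr) s hs.1.le).hasDerivAt (Ici_mem_nhds hs.1))
    rw [hV y hyr, drift, h3, hgG s hs] at h5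
    have h6 : (-V y, (1 : ℝ)) = (0, 1) - (V y, 0) := by simp
    rw [h6, map_sub, h5] at h2
    simpa using h2
  rw [intervalIntegral.integral_eq_sub_of_hasDerivAt_of_le ht hcont hderiv
    (hG.intervalIntegrable _ _)]
  simp only [sub_self, sub_zero, hX.zero]
  rw [hv.init _ (hsub (hrX x hx t ht))]
  ring

theorem IsExpansion.eq_coeff (hu : IsExpansion f S φ R N u) (h : Coefficients V W A φ' γ r M n)
    (hX : IsFlow V X) (hS : Represents f S r V W A) (hr : r ≤ R) (hn : n ≠ 0) (hN : 2 * N ≤ n)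
    (hφ : ∀ x ∈ ball (0 : EuclideanSpace ℝ (Fin d)) r, φ' x = φ x) (l : ℕ) (hl : l ≤ N) :
    ∀ x ∈ ball (0 : EuclideanSpace ℝ (Fin d)) r, ∀ t : ℝ, 0 ≤ t →
      u l x t = coeff X W A φ' l x t := by
  have hrX : ∀ x ∈ ball (0 : EuclideanSpace ℝ (Fin d)) r, ∀ t : ℝ, 0 ≤ t → X x t ∈ ball 0 r :=
    fun x hx t ht => h.field.mem_ball hX hx ht
  have hXc := h.field.contDiff_flow hn hX
  induction l with
  | zero =>
    intro x hx t ht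
    rw [hu.zero.eq_duhamel hX hr hrX hS.first hx ht (G := fun _ => 0) continuous_const
      (fun _ _ => rfl)]
    simp [coeff, hφ _ (hrX x hx t ht)]
  | succ l ih =>
    intro x hx t ht
    have hc := h.contDiff_secondOrder (m := 0) (by omega)
      (h.contDiff_coeff hn hX l (m := 0 + 2) (by omega))
    have hXx : Continuous (X x) := (contDiff_time hXc x).continuous
    have hG : Continuous fun s => secondOrder W A (fun y => coeff X W A φ' l y s) (X x (t - s)) :=
      hc.continuous.comp (f := fun s => (X x (t - s), s)) (by fun_prop)
    rw [(hu.succ l (by omega)).eq_duhamel hX hr hrX hS.first hx ht hG (fun s hs => ?_), coeff,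
      zero_add]
    have hy := hrX x hx _ (sub_nonneg.2 hs.2.le)
    have e : (fun y => u l y s) =ᶠ[𝓝 (X x (t - s))] fun y => coeff X W A φ' l y s :=
      Filter.eventually_of_mem (isOpen_ball.mem_nhds hy) fun y hy => ih (by omega) y hy s hs.1.le
    rw [L2_congr e, hS.second _ hy]

theorem truncation_eq_partialSum {c : ℕ → EuclideanSpace ℝ (Fin d) → ℝ → ℝ}
    {x : EuclideanSpace ℝ (Fin d)} {t : ℝ} (h : ∀ l ≤ N, u l x t = c l x t) (η : ℝ) :
    truncation u η N x t = partialSum η c N x t :=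
  Finset.sum_congr rfl fun l hl => by rw [h l (Nat.lt_succ_iff.1 (Finset.mem_range.1 hl))]

/-- All three conclusions are local in space, so they can be checked at one point `x₀` with
coefficients adapted to it. The constants are fixed before `x₀` is chosen. -/
theorem exists_expansion_bound (d N k : ℕ) (hk : 1 ≤ k) (γ : ℝ) (hγ : 0 < γ) :
    ∃ C K : ℝ, ∃ p : ℕ, ∀ (f φ : EuclideanSpace ℝ (Fin d) → ℝ)
      (S : EuclideanSpace ℝ (Fin d) → Matrix (Fin d) (Fin d) ℝ) (R η : ℝ)
      (u : ℕ → EuclideanSpace ℝ (Fin d) → ℝ → ℝ),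
      0 < η → η ≤ 1 / (2 * γ) → MemCk (2 * k + 2 * N) (ball 0 R) φ →
      MemCk (2 * k + 2 * N + 1) (ball 0 R) f →
      MemCk (2 * k + 2 * N - 2) (ball 0 R) (fun x => (fun i j => S x i j : Fin d → Fin d → ℝ)) →
      gradient f 0 = 0 →
      (∀ x ∈ ball (0 : EuclideanSpace ℝ (Fin d)) R, ∀ y ∈ ball (0 : EuclideanSpace ℝ (Fin d)) R,
        γ * ‖x - y‖ ^ 2 ≤ inner ℝ (gradient f x - gradient f y) (x - y)) →
      IsExpansion f S φ R N u → ∀ x₀ ∈ ball (0 : EuclideanSpace ℝ (Fin d)) R, ∀ t : ℝ, 0 ≤ t →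
      (∀ l ≤ N, ContDiffWithinAt ℝ ((2 * k + 2 * (N - l) : ℕ) : WithTop ℕ∞)
        (fun p : EuclideanSpace ℝ (Fin d) × ℝ => u l p.1 p.2) (ball 0 R ×ˢ Ici 0) (x₀, t)) ∧
      HasDerivWithinAt (truncation u η N x₀)
        (LL f S η (fun y => truncation u η N y t) x₀
          - η ^ (N + 1) * L2 f S (fun y => u N y t) x₀) (Ici 0) t ∧
      |iteratedDerivWithin k (truncation u η N x₀) (Ici 0) t
          - (LL f S η)^[k] (fun y => truncation u η N y t) x₀| ≤
        C * (K * (1 + (ckNorm (2 * k + 2 * N) (ball 0 R) φ).toReal +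
          (ckNorm (2 * k + 2 * N + 1) (ball 0 R) f).toReal +
          (ckNorm (2 * k + 2 * N - 2) (ball 0 R)
            (fun x => (fun i j => S x i j : Fin d → Fin d → ℝ))).toReal) ^ 2) ^ p *
          Real.exp (-γ * t / 2) * η ^ (N + 1) := by
  obtain ⟨C, p, -, hC⟩ := exists_residual_decay (EuclideanSpace ℝ (Fin d)) hγ (N := N) hk
    (half_lt_self hγ) (η₀ := 1 / (2 * γ)) (by positivity) k le_rfl
  refine ⟨C, 2 ^ (2 * k + 2 * N) + ‖tracePairing d‖ + 1, p, ?_⟩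
  intro f φ S R η u hη hηle hφ hf hS h0 hmono hu x₀ hx₀ t ht
  rw [mem_ball_zero_iff] at hx₀
  -- Any radius strictly between `‖x₀‖` and `R` would do: `x₀` is interior to the smaller ball, and
  -- the cutoff has room inside the larger one.
  set r := (‖x₀‖ + R) / 2 with hr
  have hrR : r < R := by linarith
  have hr0 : 0 < r := by linarith [norm_nonneg x₀]
  have hx₀r : x₀ ∈ ball (0 : EuclideanSpace ℝ (Fin d)) r := by
    rw [mem_ball_zero_iff]; linarith
  obtain ⟨V, W, A, φ', h, hrep, hφ'⟩ := exists_coefficients (n := 2 * k + 2 * N) (by omega) hγ.le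
    hr0 hrR hφ hf hS h0 hmono
  obtain ⟨K, hK⟩ := h.field.lipschitz
  obtain ⟨L, hL⟩ := h.field.bounded
  obtain ⟨X, hX⟩ := exists_isFlow hK hL
  have hu' := fun l hl => hu.eq_coeff h hX hrep hrR.le (by omega) (by omega) hφ' l hl
  have htr : ∀ x ∈ ball (0 : EuclideanSpace ℝ (Fin d)) r, ∀ t : ℝ, 0 ≤ t →
      truncation u η N x t = partialSum η (coeff X W A φ') N x t :=
    fun x hx t ht => truncation_eq_partialSum (fun l hl => hu' l hl x hx t ht) η
  refine ⟨fun l hl => ?_, ?_, ?_⟩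
  · have h1 := h.contDiff_coeff (by omega) hX l (m := 2 * k + 2 * (N - l)) (by omega)
    refine h1.contDiffAt.contDiffWithinAt.congr_of_eventuallyEq_of_mem ?_
      ⟨mem_ball_zero_iff.2 hx₀, ht⟩
    have h2 : ∀ᶠ q : EuclideanSpace ℝ (Fin d) × ℝ in 𝓝[ball 0 R ×ˢ Ici 0] (x₀, t),
        q.1 ∈ ball (0 : EuclideanSpace ℝ (Fin d)) r :=
      mem_nhdsWithin_of_mem_nhds (continuousAt_fst (isOpen_ball.mem_nhds hx₀r))
    filter_upwards [h2, self_mem_nhdsWithin] with q hq hq'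
    exact hu' l hl q.1 hq q.2 hq'.2
  · have h1 := (h.hasDerivAt_partialSum hX η N (by omega) x₀ t).hasDerivWithinAt (s := Ici 0)
    have e1 := hrep.iterate (fun x hx => htr x hx t ht) η 1 x₀ hx₀r
    have e2 : (fun y => u N y t) =ᶠ[𝓝 x₀] fun y => coeff X W A φ' N y t :=
      Filter.eventually_of_mem (isOpen_ball.mem_nhds hx₀r) fun y hy => hu' N le_rfl y hy t ht
    simp only [Function.iterate_one] at e1
    rw [e1, L2_congr e2, hrep.second x₀ hx₀r]
    exact h1.congr_of_mem (fun s hs => htr x₀ hx₀r s hs) ht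
  · have h1 := (hC V W A φ' X r _ η h hX hη.le hηle).bound x₀ hx₀r t ht 0 le_rfl (Nat.zero_le _)
    rw [norm_iteratedFDeriv_zero, Real.norm_eq_abs] at h1
    -- The Duhamel coefficients are smooth for all real times, so the one-sided derivatives on
    -- `[0,∞)`, also at `t = 0`, are ordinary derivatives of their partial sum.
    have e1 : iteratedDerivWithin k (truncation u η N x₀) (Ici 0) t =
        iteratedDeriv k (partialSum η (coeff X W A φ') N x₀) t := by
      rw [iteratedDerivWithin_congr (s := Ici (0 : ℝ)) (fun s hs => htr x₀ hx₀r s hs) ht]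
      refine iteratedDerivWithin_eq_iteratedDeriv (uniqueDiffOn_Ici 0) ?_ ht
      exact (contDiff_time (h.contDiff_partialSum (by omega) hX η N (m := k) (by omega))
        x₀).contDiffAt
    rw [e1, hrep.iterate (fun x hx => htr x hx t ht) η k x₀ hx₀r]
    refine h1.trans (le_of_eq ?_)
    have : -(γ / 2) * t = -γ * t / 2 := by ring
    rw [this]
    ring

end SGDExpansion

theorem corollary1 (d N k : ℕ) (hk : 1 ≤ k) (γ : ℝ) (hγ : 0 < γ) :
    ∃ Q : MvPolynomial (Fin 3) ℝ,
      ∀ {Ξ : Type*} [MeasurableSpace Ξ] (P : Measure Ξ) [IsProbabilityMeasure P]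
        (F : Ξ → EuclideanSpace ℝ (Fin d) → ℝ) (f φ : EuclideanSpace ℝ (Fin d) → ℝ)
        (b R₁ R η : ℝ) (u : ℕ → EuclideanSpace ℝ (Fin d) → ℝ → ℝ),
        SGDExpansion.Assumption P F f γ b R₁ →
        16 * b / (3 * γ) < R → R ≤ R₁ →
        0 < η → η ≤ SGDExpansion.stepBound γ b R →
        SGDExpansion.MemCk (2 * k + 2 * N) (ball 0 R) φ →
        SGDExpansion.MemCk (2 * k + 1 + 2 * N) (ball 0 R) f →
        SGDExpansion.MemCk (2 * k + 2 * N - 2) (ball 0 R)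
          (fun x => (fun i j => SGDExpansion.covMatrix P F f x i j : Fin d → Fin d → ℝ)) →
        SGDExpansion.IsExpansion f (SGDExpansion.covMatrix P F f) φ R N u →
        (∀ l ≤ N, ContDiffOn ℝ ((2 * k + 2 * (N - l) : ℕ) : WithTop ℕ∞)
          (fun p : EuclideanSpace ℝ (Fin d) × ℝ => u l p.1 p.2) (ball 0 R ×ˢ Ici 0)) ∧
        (∀ x ∈ ball (0 : EuclideanSpace ℝ (Fin d)) R, ∀ t : ℝ, 0 ≤ t →
          HasDerivWithinAt (SGDExpansion.truncation u η N x)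
            (SGDExpansion.LL f (SGDExpansion.covMatrix P F f) η
                (fun y => SGDExpansion.truncation u η N y t) x
              - η ^ (N + 1) *
                SGDExpansion.L2 f (SGDExpansion.covMatrix P F f) (fun y => u N y t) x)
            (Ici 0) t) ∧
        (∀ x ∈ ball (0 : EuclideanSpace ℝ (Fin d)) R, ∀ t : ℝ, 0 ≤ t →
          |iteratedDerivWithin k (SGDExpansion.truncation u η N x) (Ici 0) t
            - (SGDExpansion.LL f (SGDExpansion.covMatrix P F f) η)^[k]
                (fun y => SGDExpansion.truncation u η N y t) x|
          ≤ MvPolynomial.eval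
              ![(SGDExpansion.ckNorm (2 * k + 2 * N) (ball 0 R) φ).toReal,
                (SGDExpansion.ckNorm (2 * k + 1 + 2 * N) (ball 0 R) f).toReal,
                (SGDExpansion.ckNorm (2 * k + 2 * N - 2) (ball 0 R)
                  (fun x => (fun i j => SGDExpansion.covMatrix P F f x i j :
                    Fin d → Fin d → ℝ))).toReal] Q
            * Real.exp (-γ * t / 2) * η ^ (N + 1)) := by
  obtain ⟨C, K, p, h⟩ := SGDExpansion.exists_expansion_bound d N k hk γ hγ
  -- The bound is `C M^p` with `M = K (1 + X₀ + X₁ + X₂)²`, a polynomial in the three norms, whence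
  -- the exponent `2 * p`.
  refine ⟨MvPolynomial.C (C * K ^ p) *
    (1 + MvPolynomial.X 0 + MvPolynomial.X 1 + MvPolynomial.X 2) ^ (2 * p), ?_⟩
  intro Ξ _ P _ F f φ b R₁ R η u hA _ hR hη hηle hφ hf hS hu
  rw [show 2 * k + 1 + 2 * N = 2 * k + 2 * N + 1 by ring] at hf ⊢
  have hmain := h f φ (SGDExpansion.covMatrix P F f) R η u hη (hηle.trans (min_le_left _ _)) hφ hf
    hS hA.gradient_zero
    (fun x hx y hy => hA.monotone (ball_subset_ball hR hx) (ball_subset_ball hR hy)) hu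
  refine ⟨fun l hl q hq => (hmain q.1 hq.1 q.2 hq.2).1 l hl,
    fun x hx t ht => (hmain x hx t ht).2.1, fun x hx t ht => ?_⟩
  refine (hmain x hx t ht).2.2.trans (le_of_eq ?_)
  simp only [map_mul, map_pow, map_add, map_one, MvPolynomial.eval_C, MvPolynomial.eval_X,
    Matrix.cons_val_zero, Matrix.cons_val_one, Matrix.cons_val]
  rw [mul_pow, ← pow_mul]
  ring
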